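/- Let $d\ge 2$, let $\Omega\subset\mathbb R^d$ be a bounded domain (open, connected, non-empty) with Lipschitz boundary, and let $\Omega_1$ be a non-empty open set with $\overline{\Omega_1}\subset\Omega$, such that $\Gamma:=\partial\Omega_1$ is Lipschitz and $\Omega_2:=\Omega\setminus\overline{\Omega_1}$ is connected. Let $\sigma=\sigma_1\chi_{\Omega_1}+\sigma_2\chi_{\Omega_2}$ with constants $\sigma_1,\sigma_2>0$, let $g,u_a\in L^2(\partial\Omega)$ and $\lambda\in\mathbb R$. Let $ds$ denote surface measure; boundary values of $H^1(\Omega)$ functions on $\Gamma$ and on $\partial\Omega$ are understood in the sense of traces. For $\gamma\in C(\Gamma)$ with $\gamma>0$ on $\Gamma$ let the state $u=u(\gamma)\in H^1(\Omega)$ be the solution of $$\int_\Omega\sigma\nabla u\cdot\nabla w\,dx+\int_\Gamma\gamma uw\,ds=\int_{\partial\Omega}gw\,ds\qquad\text{for all }w\in H^1(\Omega),$$ let the adjoint state $v=v(\gamma)\in H^1(\Omega)$ be the solution of $$\int_\Omega\sigma\nabla v\cdot\nabla w\,dx+\int_\Gamma\gamma vw\,ds+\int_{\partial\Omega}(u-u_a)w\,ds=0\qquad\text{for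 all }w\in H^1(\Omega),$$ and put $$J(\gamma)=\frac12\int_{\partial\Omega}(u(\gamma)-u_a)^2\,ds+\frac\lambda2\int_\Gamma\gamma^2\,ds .$$ Then, for every $\gamma\in C(\Gamma)$ with $\gamma>0$ on $\Gamma$, the state $u$ and the adjoint state $v$ exist and are unique, and $J$ is Gateaux differentiable at $\gamma$: for every $\hat\gamma\in C(\Gamma)$ the function $t\mapsto J(\gamma+t\hat\gamma)$, which is defined for all small $|t|$, is differentiable at $t=0$ with derivative $$D_\gamma J(\gamma;\hat\gamma)=\int_\Gamma\hat\gamma\,(uv+\lambda\gamma)\,ds,$$ and $\hat\gamma\mapsto D_\gamma J(\gamma;\hat\gamma)$ is a continuous linear functional on $C(\Gamma)$. -/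

import Mathlib

open MeasureTheory Set Filter Topology
open scoped ContDiff RealInnerProductSpace ENNReal

noncomputable section

namespace RobinTransmission

/-- Euclidean space of dimension `d`. -/
abbrev E (d : ℕ) : Type := EuclideanSpace ℝ (Fin d)

variable {d : ℕ}

/-- The boundary of `U` is Lipschitz: near each boundary point, `U` is the set of points lying
strictly above the graph of a Lipschitz function over a hyperplane `e^⊥`, in the direction of
the unit vector `e`. -/
def HasLipschitzBoundary (U : Set (E d)) : Prop :=
  ∀ x₀ ∈ frontier U, ∃ (e : E d) (ψ : (ℝ ∙ e)ᗮ → ℝ) (K : NNReal),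
    ‖e‖ = 1 ∧ LipschitzWith K ψ ∧
      ∀ᶠ x in 𝓝 x₀, (x ∈ U ↔ ψ ((ℝ ∙ e)ᗮ.orthogonalProjectionOnto x) < ⟪e, x⟫)

/-- The surface measure `ds` on a hypersurface `S` of `ℝ^d`: the `(d-1)`-dimensional Hausdorff
measure, in the normalization that agrees with Lebesgue measure on `(d-1)`-dimensional Euclidean
spaces. -/
def surfaceMeasure (S : Set (E d)) : Measure S := Measure.euclideanHausdorffMeasure (d - 1)

/-- The space `L²(S)` on a hypersurface. -/
abbrev L2Surface (S : Set (E d)) : Type := Lp ℝ 2 (surfaceMeasure S)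

/-- The vector field `G` is the weak gradient of `u` in the open set `Ω`. -/
def HasWeakGradient (Ω : Set (E d)) (u : E d → ℝ) (G : E d → E d) : Prop :=
  ∀ φ : E d → ℝ, ContDiff ℝ ∞ φ → HasCompactSupport φ → tsupport φ ⊆ Ω →
    ∀ y : E d, ∫ x in Ω, u x * fderiv ℝ φ x y = - ∫ x in Ω, φ x * ⟪G x, y⟫

/-- `L²(Ω) × L²(Ω; ℝ^d)` with its Hilbert space structure. -/
abbrev L2Pair (Ω : Set (E d)) : Type :=
  WithLp 2 (Lp ℝ 2 (volume.restrict Ω) × Lp (E d) 2 (volume.restrict Ω))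

/-- A test function times a square integrable function is integrable. -/
theorem integrable_smul_test {F : Type*} [NormedAddCommGroup F] [NormedSpace ℝ F]
    {Ω : Set (E d)} (f : Lp F 2 (volume.restrict Ω)) {φ : E d → ℝ} (hφ : Continuous φ)
    (hc : HasCompactSupport φ) :
    Integrable (fun x => φ x • f x) (volume.restrict Ω) := by
  have h1 : MemLp φ 2 (volume.restrict Ω) := hφ.memLp_of_hasCompactSupport hc
  exact memLp_one_iff_integrable.1 ((Lp.memLp f).smul h1)

theorem integrable_inner_test {Ω : Set (E d)} (G : Lp (E d) 2 (volume.restrict Ω))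
    {φ : E d → ℝ} (hφ : Continuous φ) (hc : HasCompactSupport φ) (y : E d) :
    Integrable (fun x => φ x * ⟪G x, y⟫) (volume.restrict Ω) := by
  have h := (integrable_smul_test G hφ hc).inner_const (𝕜 := ℝ) y
  simpa [real_inner_smul_left] using h

theorem integrable_fderiv_test {Ω : Set (E d)} (u : Lp ℝ 2 (volume.restrict Ω))
    {φ : E d → ℝ} (hφ : ContDiff ℝ ∞ φ) (hc : HasCompactSupport φ) (y : E d) :
    Integrable (fun x => u x * fderiv ℝ φ x y) (volume.restrict Ω) := by
  have h1 : Continuous (fun x => fderiv ℝ φ x y) :=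
    (hφ.continuous_fderiv (by simp)).clm_apply continuous_const
  have h2 : HasCompactSupport (fun x => fderiv ℝ φ x y) := hc.fderiv_apply (𝕜 := ℝ) y
  simpa [mul_comm] using integrable_smul_test u h1 h2

/-- The Sobolev space `H¹(Ω)`, as the space of pairs `(u, ∇u)` of a function `u ∈ L²(Ω)` with its
(uniquely determined) weak gradient `∇u ∈ L²(Ω; ℝ^d)`; the induced norm is the usual one,
`‖u‖² = ‖u‖²_{L²} + ‖∇u‖²_{L²}`. -/
def H1 (Ω : Set (E d)) : Submodule ℝ (L2Pair Ω) where
  carrier := {p | HasWeakGradient Ω p.fst p.snd}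
  zero_mem' := by
    intro φ _ _ _ y
    have h1 : ∫ x in Ω, ((0 : L2Pair Ω).fst : E d → ℝ) x * fderiv ℝ φ x y = 0 := by
      refine integral_eq_zero_of_ae ?_
      filter_upwards [Lp.coeFn_zero ℝ 2 (volume.restrict Ω)] with x hx
      simp only [WithLp.zero_fst, hx, Pi.zero_apply, zero_mul]
    have h2 : ∫ x in Ω, φ x * ⟪((0 : L2Pair Ω).snd : E d → E d) x, y⟫ = 0 := by
      refine integral_eq_zero_of_ae ?_
      filter_upwards [Lp.coeFn_zero (E d) 2 (volume.restrict Ω)] with x hx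
      simp only [WithLp.zero_snd, hx, Pi.zero_apply, inner_zero_left, mul_zero]
    rw [h1, h2, neg_zero]
  add_mem' := by
    intro p q hp hq φ hφ hc hs y
    have h1 : ∫ x in Ω, ((p + q).fst : E d → ℝ) x * fderiv ℝ φ x y
        = (∫ x in Ω, (p.fst : E d → ℝ) x * fderiv ℝ φ x y)
          + ∫ x in Ω, (q.fst : E d → ℝ) x * fderiv ℝ φ x y := by
      rw [← integral_add (integrable_fderiv_test _ hφ hc y) (integrable_fderiv_test _ hφ hc y)]
      refine integral_congr_ae ?_
      filter_upwards [Lp.coeFn_add p.fst q.fst] with x hx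
      simp only [WithLp.add_fst, hx, Pi.add_apply, add_mul]
    have h2 : ∫ x in Ω, φ x * ⟪((p + q).snd : E d → E d) x, y⟫
        = (∫ x in Ω, φ x * ⟪(p.snd : E d → E d) x, y⟫)
          + ∫ x in Ω, φ x * ⟪(q.snd : E d → E d) x, y⟫ := by
      rw [← integral_add (integrable_inner_test _ hφ.continuous hc y)
        (integrable_inner_test _ hφ.continuous hc y)]
      refine integral_congr_ae ?_
      filter_upwards [Lp.coeFn_add p.snd q.snd] with x hx
      simp only [WithLp.add_snd, hx, Pi.add_apply, inner_add_left, mul_add]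
    rw [h1, h2, hp φ hφ hc hs y, hq φ hφ hc hs y, neg_add]
  smul_mem' := by
    intro c p hp φ hφ hc hs y
    have h1 : ∫ x in Ω, ((c • p).fst : E d → ℝ) x * fderiv ℝ φ x y
        = c * ∫ x in Ω, (p.fst : E d → ℝ) x * fderiv ℝ φ x y := by
      rw [← integral_const_mul]
      refine integral_congr_ae ?_
      filter_upwards [Lp.coeFn_smul c p.fst] with x hx
      simp only [WithLp.smul_fst, hx, Pi.smul_apply, smul_eq_mul, mul_assoc]
    have h2 : ∫ x in Ω, φ x * ⟪((c • p).snd : E d → E d) x, y⟫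
        = c * ∫ x in Ω, φ x * ⟪(p.snd : E d → E d) x, y⟫ := by
      rw [← integral_const_mul]
      refine integral_congr_ae ?_
      filter_upwards [Lp.coeFn_smul c p.snd] with x hx
      simp only [WithLp.smul_snd, hx, Pi.smul_apply, real_inner_smul_left]
      ring
    rw [h1, h2, hp φ hφ hc hs y, mul_neg]

/-- The function underlying an element of `H¹(Ω)`. -/
def toL2 {Ω : Set (E d)} (u : H1 Ω) : Lp ℝ 2 (volume.restrict Ω) := (u : L2Pair Ω).fst

/-- The weak gradient of an element of `H¹(Ω)`. -/
def grad {Ω : Set (E d)} (u : H1 Ω) : Lp (E d) 2 (volume.restrict Ω) := (u : L2Pair Ω).snd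

/-- `f ∈ L²(S)` is the trace on `S ⊆ closure Ω` of `u ∈ H¹(Ω)`: there are functions `φ n`, smooth
up to the boundary, with `φ n → u` in `H¹(Ω)` and `φ n |_S → f` in `L²(S)`. -/
def IsTrace {Ω : Set (E d)} (S : Set (E d)) (u : H1 Ω) (f : L2Surface S) : Prop :=
  ∃ φ : ℕ → E d → ℝ, (∀ n, ContDiff ℝ ∞ (φ n)) ∧
    Tendsto (fun n => eLpNorm (fun x => φ n x - toL2 u x) 2 (volume.restrict Ω)) atTop (𝓝 0) ∧
    Tendsto (fun n => eLpNorm (fun x => gradient (φ n) x - grad u x) 2 (volume.restrict Ω))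
      atTop (𝓝 0) ∧
    Tendsto (fun n => eLpNorm (fun s : S => φ n s - f s) 2 (surfaceMeasure S)) atTop (𝓝 0)

/-- The Dirichlet trace operator `H¹(Ω) → L²(S)`. For `Ω` a bounded Lipschitz domain and `S` its
boundary, or the Lipschitz boundary of an open set compactly contained in `Ω`, each element of
`H¹(Ω)` has exactly one trace on `S`. -/
def trace {Ω : Set (E d)} (S : Set (E d)) (u : H1 Ω) : L2Surface S :=
  Classical.epsilon fun f => IsTrace S u f

/-- The conductivity `σ = σ₁ χ_{Ω₁} + σ₂ χ_{Ω₂}`, with `Ω₂ = Ω \ closure Ω₁`. -/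
def conductivity (Ω Ω₁ : Set (E d)) (σ₁ σ₂ : ℝ) (x : E d) : ℝ :=
  Ω₁.indicator (fun _ => σ₁) x + (Ω \ closure Ω₁).indicator (fun _ => σ₂) x

/-- The bilinear form `∫_Ω σ ∇u·∇w dx + ∫_Γ γ u w ds` on `H¹(Ω)`, with `Γ = ∂Ω₁`. -/
def robinForm (Ω Ω₁ : Set (E d)) (σ₁ σ₂ : ℝ) (γ : C(frontier Ω₁, ℝ)) (u w : H1 Ω) : ℝ :=
  (∫ x in Ω, conductivity Ω Ω₁ σ₁ σ₂ x * ⟪grad u x, grad w x⟫) +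
    ∫ s, γ s * trace (frontier Ω₁) u s * trace (frontier Ω₁) w s ∂(surfaceMeasure (frontier Ω₁))

/-- `u` is the state for the Robin coefficient `γ` and the Neumann datum `g`:
`∫_Ω σ ∇u·∇w dx + ∫_Γ γ u w ds = ∫_{∂Ω} g w ds` for all `w ∈ H¹(Ω)`. -/
def IsState (Ω Ω₁ : Set (E d)) (σ₁ σ₂ : ℝ) (g : L2Surface (frontier Ω))
    (γ : C(frontier Ω₁, ℝ)) (u : H1 Ω) : Prop :=
  ∀ w : H1 Ω, robinForm Ω Ω₁ σ₁ σ₂ γ u w =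
    ∫ s, g s * trace (frontier Ω) w s ∂(surfaceMeasure (frontier Ω))

/-- `v` is the adjoint state for `γ`, the state `u` and the measured datum `uₐ`:
`∫_Ω σ ∇v·∇w dx + ∫_Γ γ v w ds + ∫_{∂Ω} (u - uₐ) w ds = 0` for all `w ∈ H¹(Ω)`. -/
def IsAdjointState (Ω Ω₁ : Set (E d)) (σ₁ σ₂ : ℝ) (uₐ : L2Surface (frontier Ω))
    (γ : C(frontier Ω₁, ℝ)) (u v : H1 Ω) : Prop :=
  ∀ w : H1 Ω, robinForm Ω Ω₁ σ₁ σ₂ γ v w +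
    ∫ s, (trace (frontier Ω) u s - uₐ s) * trace (frontier Ω) w s
      ∂(surfaceMeasure (frontier Ω)) = 0

/-- The coefficient-to-state map `γ ↦ u(γ)`; it is meaningful when `γ > 0` on `Γ`, in which case
there is exactly one state. -/
def state (Ω Ω₁ : Set (E d)) (σ₁ σ₂ : ℝ) (g : L2Surface (frontier Ω))
    (γ : C(frontier Ω₁, ℝ)) : H1 Ω :=
  Classical.epsilon fun u => IsState Ω Ω₁ σ₁ σ₂ g γ u

/-- The cost functional
`J(γ) = 1/2 ∫_{∂Ω} (u(γ) - uₐ)² ds + lam/2 ∫_Γ γ² ds`. -/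
def cost (Ω Ω₁ : Set (E d)) (σ₁ σ₂ : ℝ) (g uₐ : L2Surface (frontier Ω)) (lam : ℝ)
    (γ : C(frontier Ω₁, ℝ)) : ℝ :=
  1 / 2 * (∫ s, (trace (frontier Ω) (state Ω Ω₁ σ₁ σ₂ g γ) s - uₐ s) ^ 2
      ∂(surfaceMeasure (frontier Ω))) +
    lam / 2 * ∫ s, γ s ^ 2 ∂(surfaceMeasure (frontier Ω₁))

end RobinTransmission

end

/-!
The state and the adjoint equation are coercive variational problems on `H¹(Ω)`, and the derivative
of the cost comes out of testing the adjoint equation with the difference of two states. What has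
to be supplied are the properties of `H¹(Ω)`, which are proved here from the definitions.

* Trace inequality (`exists_trace_bound`). On a Lipschitz graph, the surface measure is at most
  a multiple of Lebesgue measure on the base hyperplane, since the graph map is Lipschitz. On each
  line in the direction of the chart, the value of a smooth function at the graph is controlled by
  the function and its derivative along a segment of fixed length inside the domain; Fubini
  integrates this over the base, and finitely many charts cover the compact surface.
* Density of smooth functions (`exists_smooth_approx`). Near a boundary point, a function is
  mollified with a kernel that is shifted along the direction of the chart, so that the convolution
  only sees values from inside the domain. A partition of unity patches these approximations.
  With the trace inequality, the trace becomes a bounded operator (`exists_traceL`).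
* Poincaré inequality (`controlled_of_lipschitz`, `exists_poincare`). Say that a set is controlled
  if the `L²` norm over it is bounded by the `L²` norm on `Γ` and the `L²` norm of the gradient on
  `Ω`. Integration along lines that start on `Γ` shows that some ball is controlled, control spreads
  from a ball to a translated one by integration along segments, hence to a
  neighbourhood of each point of the connected set `Ω`, and by the charts up to its boundary.

The inequality makes the Robin form coercive for positive `γ`; the interface, on which the
conductivity vanishes by definition, is a null set because its area is finite. Lax–Milgram gives
existence and uniqueness (`exists_forall_eq_iff_of_isCoercive`). If `u t` is the state for
`γ + t γ'` and `δ = u t - u 0`, then `δ = O(t)` by coercivity, and the symmetry of the form together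
with the two equations gives `∫ (u 0 - uₐ) δ = t ∫ γ' (u t) v`, so the observation term has the
derivative `∫ γ' u v` (`hasDerivAt_half_norm_sq`); the penalty term is a quadratic
polynomial in `t`.
-/

open scoped NNReal

noncomputable section

namespace RobinTransmission

variable {d : ℕ}

/-! ### Lipschitz graphs -/

/-- The parametrization `y ↦ y + ψ(y) e` of the graph of `ψ : e^⊥ → ℝ`. -/
def graphMap (e : E d) (ψ : (ℝ ∙ e)ᗮ → ℝ) (y : (ℝ ∙ e)ᗮ) : E d := (y : E d) + ψ y • e

section Graph

variable {e : E d} {ψ : (ℝ ∙ e)ᗮ → ℝ} {K : ℝ≥0}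

theorem inner_orthogonal (y : (ℝ ∙ e)ᗮ) : ⟪e, (y : E d)⟫ = 0 :=
  Submodule.mem_orthogonal_singleton_iff_inner_right.1 y.2

theorem inner_graphMap_add (he : ‖e‖ = 1) (y : (ℝ ∙ e)ᗮ) (t : ℝ) :
    ⟪e, graphMap e ψ y + t • e⟫ = ψ y + t := by
  simp [graphMap, inner_add_right, inner_smul_right, inner_orthogonal, he]

theorem proj_add_smul (x : E d) (t : ℝ) :
    (ℝ ∙ e)ᗮ.orthogonalProjectionOnto (x + t • e) = (ℝ ∙ e)ᗮ.orthogonalProjectionOnto x := by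
  have h : (ℝ ∙ e)ᗮ.orthogonalProjectionOnto e = 0 := by
    rw [Submodule.orthogonalProjectionOnto_eq_zero_iff]
    exact Submodule.le_orthogonal_orthogonal _ (Submodule.mem_span_singleton_self e)
  rw [map_add, map_smul, h, smul_zero, add_zero]

theorem proj_graphMap_add (y : (ℝ ∙ e)ᗮ) (t : ℝ) :
    (ℝ ∙ e)ᗮ.orthogonalProjectionOnto (graphMap e ψ y + t • e) = y := by
  rw [proj_add_smul, graphMap, proj_add_smul]
  simp

theorem proj_graphMap (y : (ℝ ∙ e)ᗮ) :
    (ℝ ∙ e)ᗮ.orthogonalProjectionOnto (graphMap e ψ y) = y := by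
  simpa using proj_graphMap_add (ψ := ψ) y 0

theorem graphMap_proj_add (he : ‖e‖ = 1) (x : E d) :
    graphMap e ψ ((ℝ ∙ e)ᗮ.orthogonalProjectionOnto x) +
      (⟪e, x⟫ - ψ ((ℝ ∙ e)ᗮ.orthogonalProjectionOnto x)) • e = x := by
  have h := (ℝ ∙ e).starProjection_add_starProjection_orthogonal x
  rw [Submodule.starProjection_unit_singleton ℝ he] at h
  have h2 : (((ℝ ∙ e)ᗮ.orthogonalProjectionOnto x : (ℝ ∙ e)ᗮ) : E d) = (ℝ ∙ e)ᗮ.starProjection x :=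
    rfl
  rw [graphMap, h2, sub_smul]
  conv_rhs => rw [← h]
  abel

theorem norm_proj_sub_le (x z : E d) :
    ‖(ℝ ∙ e)ᗮ.orthogonalProjectionOnto x - (ℝ ∙ e)ᗮ.orthogonalProjectionOnto z‖ ≤ ‖x - z‖ := by
  rw [← map_sub]
  exact Submodule.norm_orthogonalProjectionOnto_apply_le _ _

theorem continuous_proj : Continuous fun x : E d => (ℝ ∙ e)ᗮ.orthogonalProjectionOnto x :=
  ((ℝ ∙ e)ᗮ.orthogonalProjectionOnto).continuous

theorem continuous_graphMap (hψ : Continuous ψ) : Continuous (graphMap e ψ) := by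
  unfold graphMap; fun_prop

theorem lipschitzWith_graphMap (he : ‖e‖ = 1) (hψ : LipschitzWith K ψ) :
    LipschitzWith (1 + K) (graphMap e ψ) := by
  have h1 : LipschitzWith 1 (fun y : (ℝ ∙ e)ᗮ => (y : E d)) := LipschitzWith.subtype_val _
  have h2 : LipschitzWith K (fun y : (ℝ ∙ e)ᗮ => ψ y • e) := by
    refine LipschitzWith.of_dist_le_mul fun a b => ?_
    rw [dist_eq_norm, ← sub_smul, norm_smul, he, mul_one, ← dist_eq_norm]
    exact hψ.dist_le_mul a b
  exact h1.add h2

theorem finrank_orthogonal (he : ‖e‖ = 1) : Module.finrank ℝ (ℝ ∙ e)ᗮ = d - 1 := by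
  have h := (ℝ ∙ e).finrank_add_finrank_orthogonal
  have h0 : e ≠ 0 := by rintro rfl; simp at he
  rw [finrank_span_singleton h0, finrank_euclideanSpace_fin] at h
  omega

/-- Lebesgue measure on `e^⊥` is the `(d-1)`-dimensional Hausdorff measure. -/
theorem volume_orthogonal (he : ‖e‖ = 1) :
    (volume : Measure (ℝ ∙ e)ᗮ) = Measure.euclideanHausdorffMeasure (d - 1) := by
  rw [← InnerProductSpace.euclideanHausdorffMeasure_eq_volume, finrank_orthogonal he]

/-- A Lipschitz map increases the normalized Hausdorff measure at most by a constant factor. -/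
theorem euclideanHausdorffMeasure_image_le {X Y : Type*} [EMetricSpace X] [MeasurableSpace X]
    [BorelSpace X] [EMetricSpace Y] [MeasurableSpace Y] [BorelSpace Y] {f : X → Y} {L : ℝ≥0}
    (hf : LipschitzWith L f) (n : ℕ) (s : Set X) :
    (Measure.euclideanHausdorffMeasure n : Measure Y) (f '' s) ≤
      (L : ℝ≥0∞) ^ n * Measure.euclideanHausdorffMeasure n s := by
  rw [Measure.euclideanHausdorffMeasure_def, Measure.euclideanHausdorffMeasure_def,
    Measure.smul_apply, Measure.smul_apply, ENNReal.smul_def, ENNReal.smul_def, smul_eq_mul,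
    smul_eq_mul, mul_left_comm]
  gcongr
  simpa using hf.hausdorffMeasure_image_le (Nat.cast_nonneg n) s

/-- Surface measure on a Lipschitz graph is bounded above by a multiple of the pushforward of
Lebesgue measure on the base. -/
theorem hausdorff_restrict_le_map (he : ‖e‖ = 1) (hψ : LipschitzWith K ψ) {A : Set (E d)}
    (hA : A ⊆ range (graphMap e ψ)) :
    (Measure.euclideanHausdorffMeasure (d - 1) : Measure (E d)).restrict A ≤
      ((1 + K : ℝ≥0) : ℝ≥0∞) ^ (d - 1) • (volume : Measure (ℝ ∙ e)ᗮ).map (graphMap e ψ) := by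
  refine Measure.le_iff.2 fun B hB => ?_
  have hm : Measurable (graphMap e ψ) := (continuous_graphMap hψ.continuous).measurable
  rw [Measure.restrict_apply hB, Measure.smul_apply, Measure.map_apply hm hB, smul_eq_mul,
    volume_orthogonal he]
  calc _ ≤ (Measure.euclideanHausdorffMeasure (d - 1) : Measure (E d))
          (graphMap e ψ '' (graphMap e ψ ⁻¹' B)) := by
        refine measure_mono ?_
        rintro x ⟨hx, hxA⟩
        obtain ⟨y, rfl⟩ := hA hxA
        exact ⟨y, hx, rfl⟩
    _ ≤ _ := euclideanHausdorffMeasure_image_le (lipschitzWith_graphMap he hψ) _ _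

/-- Surface measure dominates the pushforward of Lebesgue measure on the base of a graph, as the
projection to the base is nonexpansive. -/
theorem map_graphMap_le (he : ‖e‖ = 1) (hψ : Continuous ψ) :
    (volume : Measure (ℝ ∙ e)ᗮ).map (graphMap e ψ) ≤ Measure.euclideanHausdorffMeasure (d - 1) := by
  refine Measure.le_iff.2 fun B hB => ?_
  rw [Measure.map_apply (continuous_graphMap hψ).measurable hB, volume_orthogonal he]
  have hP : LipschitzWith 1 fun x : E d => (ℝ ∙ e)ᗮ.orthogonalProjectionOnto x :=
    LipschitzWith.of_dist_le_mul fun a b => by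
      simpa [dist_eq_norm] using norm_proj_sub_le (e := e) a b
  calc _ ≤ Measure.euclideanHausdorffMeasure (d - 1)
          ((fun x : E d => (ℝ ∙ e)ᗮ.orthogonalProjectionOnto x) '' B) :=
        measure_mono fun y hy => ⟨graphMap e ψ y, hy, proj_graphMap y⟩
    _ ≤ _ := by simpa using euclideanHausdorffMeasure_image_le hP (d - 1) B

/-- Fubini's theorem along the lines parallel to the unit vector `e`. -/
theorem lintegral_eq_lintegral_lines (he : ‖e‖ = 1) {f : E d → ℝ≥0∞} (hf : Measurable f) :
    ∫⁻ x, f x = ∫⁻ y : (ℝ ∙ e)ᗮ, ∫⁻ t : ℝ, f ((y : E d) + t • e) := by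
  have h1 := ((ℝ ∙ e).measurePreserving_measurableEquivProd (0 : E d)).symm
  rw [InnerProductSpace.euclideanHausdorffMeasure_eq_volume] at h1
  rw [← h1.lintegral_comp hf, Measure.volume_eq_prod, lintegral_prod_symm _ (by fun_prop)]
  refine lintegral_congr fun y => ?_
  have h2 := (LinearIsometryEquiv.toSpanUnitSingleton e he).measurePreserving
  rw [← h2.lintegral_comp (by fun_prop)]
  refine lintegral_congr fun t => ?_
  simp [add_comm]

/-- Fubini's theorem along lines, with the origin of each line on the graph of `ψ`. -/
theorem lintegral_eq_lintegral_graph (he : ‖e‖ = 1) (hψ : Continuous ψ) {f : E d → ℝ≥0∞}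
    (hf : Measurable f) :
    ∫⁻ x, f x = ∫⁻ x, (∫⁻ t : ℝ, f (x + t • e))
      ∂((volume : Measure (ℝ ∙ e)ᗮ).map (graphMap e ψ)) := by
  have h : Measurable fun p : E d × ℝ => f (p.1 + p.2 • e) := by fun_prop
  rw [lintegral_eq_lintegral_lines he hf,
    lintegral_map h.lintegral_prod_right' (continuous_graphMap hψ).measurable]
  refine lintegral_congr fun y => ?_
  rw [← lintegral_add_left_eq_self _ (ψ y)]
  simp only [graphMap, add_smul, add_assoc]

end Graph

/-! ### Charts of a Lipschitz boundary -/

/-- In the ball of radius `r` about `x₀`, the set `U` is the strict epigraph over `e^⊥` of the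
`K`-Lipschitz function `ψ`. -/
structure EpigraphChart (U : Set (E d)) (x₀ e : E d) (ψ : (ℝ ∙ e)ᗮ → ℝ) (K : ℝ≥0) (r : ℝ) :
    Prop where
  pos : 0 < r
  norm_eq : ‖e‖ = 1
  lip : LipschitzWith K ψ
  mem_iff : ∀ x ∈ Metric.ball x₀ r,
    (x ∈ U ↔ ψ ((ℝ ∙ e)ᗮ.orthogonalProjectionOnto x) < ⟪e, x⟫)

theorem HasLipschitzBoundary.exists_chart {U : Set (E d)} (hU : HasLipschitzBoundary U) {x₀ : E d}
    (hx₀ : x₀ ∈ frontier U) :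
    ∃ (e : E d) (ψ : (ℝ ∙ e)ᗮ → ℝ) (K : ℝ≥0) (r : ℝ), EpigraphChart U x₀ e ψ K r := by
  obtain ⟨e, ψ, K, he, hψ, h⟩ := hU x₀ hx₀
  obtain ⟨r, hr, h⟩ := Metric.eventually_nhds_iff_ball.1 h
  exact ⟨e, ψ, K, r, hr, he, hψ, h⟩

namespace EpigraphChart

variable {U : Set (E d)} {x₀ e : E d} {ψ : (ℝ ∙ e)ᗮ → ℝ} {K : ℝ≥0} {r : ℝ}

theorem continuous_height (hc : EpigraphChart U x₀ e ψ K r) :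
    Continuous fun x : E d => ⟪e, x⟫ - ψ ((ℝ ∙ e)ᗮ.orthogonalProjectionOnto x) :=
  (continuous_const.inner continuous_id).sub (hc.lip.continuous.comp continuous_proj)

theorem mem_frontier_iff (hc : EpigraphChart U x₀ e ψ K r) {x : E d}
    (hx : x ∈ Metric.ball x₀ r) :
    x ∈ frontier U ↔ ψ ((ℝ ∙ e)ᗮ.orthogonalProjectionOnto x) = ⟪e, x⟫ := by
  have hB : Metric.ball x₀ r ∈ 𝓝 x := Metric.isOpen_ball.mem_nhds hx
  have hh := hc.continuous_height
  constructor
  · intro hxf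
    refine le_antisymm ?_ ?_
    · by_contra! hlt
      have h1 : ∀ᶠ z in 𝓝 x, z ∉ U := by
        filter_upwards [hB, hh.continuousAt.eventually_lt continuousAt_const (sub_neg.2 hlt)]
          with z hz hz2 hzU
        exact lt_asymm (sub_neg.1 hz2) ((hc.mem_iff z hz).1 hzU)
      exact (mem_closure_iff_frequently.1 (frontier_subset_closure hxf)) h1
    · by_contra! hlt
      have h1 : ∀ᶠ z in 𝓝 x, z ∈ U := by
        filter_upwards [hB, continuousAt_const.eventually_lt hh.continuousAt (sub_pos.2 hlt)]
          with z hz hz2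
        exact (hc.mem_iff z hz).2 (sub_pos.1 hz2)
      exact hxf.2 (mem_interior_iff_mem_nhds.2 h1)
  · intro hx0
    have hnot : x ∉ U := fun h => (hc.mem_iff x hx).1 h |>.ne hx0
    refine ⟨?_, fun h => hnot (interior_subset h)⟩
    have ht : Tendsto (fun t : ℝ => x + t • e) (𝓝[>] 0) (𝓝 x) := by
      have : ContinuousAt (fun t : ℝ => x + t • e) 0 := by fun_prop
      simpa [ContinuousAt] using this.tendsto.mono_left nhdsWithin_le_nhds
    refine mem_closure_of_tendsto ht ?_
    filter_upwards [ht hB, self_mem_nhdsWithin] with t ht1 ht2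
    refine (hc.mem_iff _ ht1).2 ?_
    rw [proj_add_smul, hx0, inner_add_right, inner_smul_right, real_inner_self_eq_norm_sq,
      hc.norm_eq]
    simpa using ht2

theorem add_smul_mem (hc : EpigraphChart U x₀ e ψ K r) {s : E d} {t : ℝ} (hs : s ∈ frontier U)
    (hsB : s ∈ Metric.ball x₀ (r / 2)) (ht : t ∈ Ioo 0 (r / 2)) : s + t • e ∈ U := by
  have hr := hc.pos
  have h1 : s + t • e ∈ Metric.ball x₀ r := by
    rw [mem_ball_iff_norm] at hsB ⊢
    calc ‖s + t • e - x₀‖ = ‖(s - x₀) + t • e‖ := by congr 1; abel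
      _ ≤ ‖s - x₀‖ + ‖t • e‖ := norm_add_le _ _
      _ < r / 2 + r / 2 := by
        rw [norm_smul, hc.norm_eq, mul_one, Real.norm_of_nonneg ht.1.le]
        exact add_lt_add hsB ht.2
      _ = r := by ring
  rw [hc.mem_iff _ h1, proj_add_smul, (hc.mem_frontier_iff (Metric.ball_subset_ball (by linarith)
    hsB)).1 hs, inner_add_right, inner_smul_right, real_inner_self_eq_norm_sq, hc.norm_eq]
  simpa using ht.1

/-- Near a boundary point, the translates of `U` in the direction `e` stay inside `U`, at a
distance to the complement proportional to the length of the translation. -/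
theorem closedBall_subset (hc : EpigraphChart U x₀ e ψ K r) {x : E d} {τ : ℝ} (hx : x ∈ U)
    (hxB : x ∈ Metric.ball x₀ (r / 3)) (hτ : τ ∈ Ioo 0 (r / 3)) :
    Metric.closedBall (x + τ • e) ((1 + K : ℝ)⁻¹ * τ) ⊆ U := by
  intro z hz
  have hK : (0 : ℝ) < 1 + K := by positivity
  set c : ℝ := (1 + K : ℝ)⁻¹
  have hc1 : (1 + K) * c = 1 := mul_inv_cancel₀ hK.ne'
  have hc2 : 0 < c := inv_pos.2 hK
  have hc3 : c ≤ 1 := inv_le_one_of_one_le₀ (by simp)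
  have hτ0 := hτ.1
  rw [mem_closedBall_iff_norm] at hz
  rw [mem_ball_iff_norm] at hxB
  have hzB : z ∈ Metric.ball x₀ r := by
    rw [mem_ball_iff_norm]
    calc ‖z - x₀‖ = ‖(z - (x + τ • e)) + (x - x₀) + τ • e‖ := by congr 1; abel
      _ ≤ ‖z - (x + τ • e)‖ + ‖x - x₀‖ + ‖τ • e‖ := norm_add₃_le
      _ < r := by
        rw [norm_smul, hc.norm_eq, mul_one, Real.norm_of_nonneg hτ.1.le]
        nlinarith [hτ.2]
  have hxB' : x ∈ Metric.ball x₀ r := by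
    rw [mem_ball_iff_norm]; linarith [hc.pos]
  rw [hc.mem_iff z hzB]
  have h1 := (hc.mem_iff x hxB').1 hx
  have h2 : ψ ((ℝ ∙ e)ᗮ.orthogonalProjectionOnto z) ≤
      ψ ((ℝ ∙ e)ᗮ.orthogonalProjectionOnto x) + K * (c * τ) := by
    have h3 := hc.lip.dist_le_mul ((ℝ ∙ e)ᗮ.orthogonalProjectionOnto z)
      ((ℝ ∙ e)ᗮ.orthogonalProjectionOnto (x + τ • e))
    rw [proj_add_smul, Real.dist_eq, dist_eq_norm] at h3
    have h4 := norm_proj_sub_le (e := e) z (x + τ • e)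
    rw [proj_add_smul] at h4
    have h5 := le_abs_self (ψ ((ℝ ∙ e)ᗮ.orthogonalProjectionOnto z) -
      ψ ((ℝ ∙ e)ᗮ.orthogonalProjectionOnto x))
    have h6 : (K : ℝ) * ‖(ℝ ∙ e)ᗮ.orthogonalProjectionOnto z -
      (ℝ ∙ e)ᗮ.orthogonalProjectionOnto x‖ ≤ K * (c * τ) :=
      mul_le_mul_of_nonneg_left (h4.trans hz) K.2
    linarith
  have h7 : ⟪e, z⟫ = ⟪e, x⟫ + τ + ⟪e, z - (x + τ • e)⟫ := by
    rw [inner_sub_right, inner_add_right, inner_smul_right, real_inner_self_eq_norm_sq, hc.norm_eq]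
    ring
  have h8 : -(c * τ) ≤ ⟪e, z - (x + τ • e)⟫ := by
    have := (abs_real_inner_le_norm e (z - (x + τ • e))).trans
      (mul_le_mul_of_nonneg_left hz (norm_nonneg e))
    rw [hc.norm_eq, one_mul] at this
    exact (abs_le.1 this).1
  have h9 : K * (c * τ) + c * τ = τ := by
    calc K * (c * τ) + c * τ = ((1 + K) * c) * τ := by ring
      _ = τ := by rw [hc1, one_mul]
  linarith

/-- The part of the boundary in the domain of a chart lies on the graph. -/
theorem frontier_subset_range (hc : EpigraphChart U x₀ e ψ K r) :
    frontier U ∩ Metric.ball x₀ r ⊆ range (graphMap e ψ) := by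
  rintro x ⟨hx, hxB⟩
  refine ⟨(ℝ ∙ e)ᗮ.orthogonalProjectionOnto x, ?_⟩
  have h := graphMap_proj_add (ψ := ψ) hc.norm_eq x
  rwa [(hc.mem_frontier_iff hxB).1 hx, sub_self, zero_smul, add_zero] at h

end EpigraphChart

/-! ### Trace inequality for smooth functions -/

/-- The Cauchy-Schwarz inequality against the constant function `1`. -/
theorem lintegral_sq_le {α : Type*} [MeasurableSpace α] {μ : Measure α} {f : α → ℝ≥0∞}
    (hf : AEMeasurable f μ) : (∫⁻ x, f x ∂μ) ^ 2 ≤ μ univ * ∫⁻ x, f x ^ 2 ∂μ := by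
  have h := ENNReal.lintegral_mul_le_Lp_mul_Lq μ Real.HolderConjugate.two_two
    (f := fun _ => 1) (g := f) aemeasurable_const hf
  simp only [Pi.mul_apply, one_mul, ENNReal.one_rpow, lintegral_const] at h
  have h2 := pow_le_pow_left₀ zero_le h 2
  refine h2.trans_eq ?_
  rw [mul_pow, ← ENNReal.rpow_natCast, ← ENNReal.rpow_natCast (_ ^ _) 2, ← ENNReal.rpow_mul,
    ← ENNReal.rpow_mul]
  norm_num

theorem enorm_sq_le_of_sub (a b : ℝ) : ‖a‖ₑ ^ 2 ≤ 2 * ‖b‖ₑ ^ 2 + 2 * ‖a - b‖ₑ ^ 2 := by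
  have h : ‖a‖ₑ ≤ ‖b‖ₑ + ‖a - b‖ₑ := by
    calc ‖a‖ₑ = ‖b + (a - b)‖ₑ := by congr 1; ring
      _ ≤ _ := enorm_add_le _ _
  calc ‖a‖ₑ ^ 2 ≤ (‖b‖ₑ + ‖a - b‖ₑ) ^ 2 := by gcongr
    _ ≤ 2 * (‖b‖ₑ ^ 2 + ‖a - b‖ₑ ^ 2) := by
        simp only [enorm_eq_nnnorm]
        exact_mod_cast add_sq_le (a := ‖b‖₊) (b := ‖a - b‖₊)
    _ = _ := mul_add _ _ _

section Segments

variable {φ : E d → ℝ}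

theorem measurable_enorm_fderiv_sq (hφ : ContDiff ℝ ∞ φ) :
    Measurable fun x => ‖fderiv ℝ φ x‖ₑ ^ 2 := by
  have := hφ.continuous_fderiv (by simp)
  exact (this.enorm.measurable).pow_const 2

theorem measurable_enorm_sq (hφ : ContDiff ℝ ∞ φ) : Measurable fun x => ‖φ x‖ₑ ^ 2 :=
  (hφ.continuous.enorm.measurable).pow_const 2

/-- The increment of a smooth function over a segment is controlled by its gradient there. -/
theorem enorm_sub_sq_le_lintegral (hφ : ContDiff ℝ ∞ φ) (x v : E d) {t : ℝ} (ht : 0 ≤ t) :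
    ‖φ (x + t • v) - φ x‖ₑ ^ 2 ≤
      ENNReal.ofReal t * ‖v‖ₑ ^ 2 * ∫⁻ τ in Ioo 0 t, ‖fderiv ℝ φ (x + τ • v)‖ₑ ^ 2 := by
  have hc : Continuous fun τ : ℝ => fderiv ℝ φ (x + τ • v) :=
    (hφ.continuous_fderiv (by simp)).comp (by fun_prop)
  have hd : ∀ τ : ℝ, HasDerivAt (fun τ : ℝ => φ (x + τ • v)) (fderiv ℝ φ (x + τ • v) v) τ := by
    intro τ
    have h1 : HasDerivAt (fun τ : ℝ => x + τ • v) v τ := by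
      simpa using ((hasDerivAt_id τ).smul_const v).const_add x
    exact ((hφ.differentiable (by simp) _).hasFDerivAt).comp_hasDerivAt τ h1
  have h1 : φ (x + t • v) - φ x = ∫ τ in Ioo 0 t, fderiv ℝ φ (x + τ • v) v := by
    have h := intervalIntegral.integral_eq_sub_of_hasDerivAt (a := 0) (b := t)
      (fun τ _ => hd τ) ((hc.clm_apply continuous_const).intervalIntegrable _ _)
    rw [intervalIntegral.integral_of_le ht, integral_Ioc_eq_integral_Ioo] at h
    simpa using h.symm
  rw [h1]
  calc ‖∫ τ in Ioo 0 t, fderiv ℝ φ (x + τ • v) v‖ₑ ^ 2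
      ≤ (∫⁻ τ in Ioo 0 t, ‖fderiv ℝ φ (x + τ • v) v‖ₑ) ^ 2 := by
        gcongr
        exact enorm_integral_le_lintegral_enorm _
    _ ≤ volume.restrict (Ioo 0 t) univ *
          ∫⁻ τ in Ioo 0 t, ‖fderiv ℝ φ (x + τ • v) v‖ₑ ^ 2 :=
        lintegral_sq_le (hc.clm_apply continuous_const).enorm.measurable.aemeasurable
    _ ≤ ENNReal.ofReal t * ∫⁻ τ in Ioo 0 t, ‖v‖ₑ ^ 2 * ‖fderiv ℝ φ (x + τ • v)‖ₑ ^ 2 := by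
        rw [Measure.restrict_apply_univ, Real.volume_Ioo, sub_zero]
        gcongr with τ
        rw [← mul_pow, mul_comm]
        gcongr
        exact ContinuousLinearMap.le_opENorm _ _
    _ = _ := by
        rw [lintegral_const_mul _ (hc.enorm.measurable.pow_const 2), mul_assoc]

/-- For `e` of length one, values of a smooth function at two points of a segment of length at most
`h` in the direction `e` are comparable up to the gradient on the segment. -/
theorem enorm_sq_le_of_segment (hφ : ContDiff ℝ ∞ φ) {e : E d} (he : ‖e‖ = 1) (x : E d) {h t : ℝ}
    (ht : t ∈ Ioo 0 h) :
    ‖φ x‖ₑ ^ 2 ≤ 2 * ‖φ (x + t • e)‖ₑ ^ 2 +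
        2 * ENNReal.ofReal h * ∫⁻ τ in Ioo 0 h, ‖fderiv ℝ φ (x + τ • e)‖ₑ ^ 2 ∧
      ‖φ (x + t • e)‖ₑ ^ 2 ≤ 2 * ‖φ x‖ₑ ^ 2 +
        2 * ENNReal.ofReal h * ∫⁻ τ in Ioo 0 h, ‖fderiv ℝ φ (x + τ • e)‖ₑ ^ 2 := by
  have h1 : ‖φ (x + t • e) - φ x‖ₑ ^ 2 ≤
      ENNReal.ofReal h * ∫⁻ τ in Ioo 0 h, ‖fderiv ℝ φ (x + τ • e)‖ₑ ^ 2 := by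
    refine (enorm_sub_sq_le_lintegral hφ x e ht.1.le).trans ?_
    have : ‖e‖ₑ = 1 := by rw [← ofReal_norm, he, ENNReal.ofReal_one]
    rw [this, one_pow, mul_one]
    gcongr
    · exact ht.2.le
    · exact ht.2.le
  have h2 : ‖φ x - φ (x + t • e)‖ₑ = ‖φ (x + t • e) - φ x‖ₑ := by rw [← enorm_neg, neg_sub]
  constructor
  · refine (enorm_sq_le_of_sub (φ x) (φ (x + t • e))).trans ?_
    rw [h2, mul_assoc 2]
    gcongr
  · refine (enorm_sq_le_of_sub (φ (x + t • e)) (φ x)).trans ?_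
    rw [mul_assoc 2]
    gcongr

end Segments

/-- Lines through the boundary: an integral over a short segment starting at the boundary is an
integral over a whole line of a function cut off outside `Ω`. -/
theorem EpigraphChart.setLIntegral_segment_le {U Ω : Set (E d)} {x₀ e : E d} {ψ : (ℝ ∙ e)ᗮ → ℝ}
    {K : ℝ≥0} {r : ℝ} (hc : EpigraphChart U x₀ e ψ K r) (hUΩ : U ⊆ Ω) (F : E d → ℝ≥0∞) {s : E d}
    (hs : s ∈ frontier U ∩ Metric.ball x₀ (r / 2)) :
    ∫⁻ τ in Ioo 0 (r / 2), F (s + τ • e) ≤ ∫⁻ τ : ℝ, Ω.indicator F (s + τ • e) := by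
  rw [← lintegral_indicator measurableSet_Ioo]
  refine lintegral_mono fun τ => ?_
  by_cases hτ : τ ∈ Ioo 0 (r / 2)
  · rw [indicator_of_mem hτ, indicator_of_mem (hUΩ (hc.add_smul_mem hs.1 hs.2 hτ))]
  · rw [indicator_of_notMem hτ]
    exact zero_le

/-- The local trace inequality, by integration along the direction transversal to the boundary. -/
theorem EpigraphChart.exists_trace_bound {U Ω : Set (E d)} {x₀ e : E d} {ψ : (ℝ ∙ e)ᗮ → ℝ}
    {K : ℝ≥0} {r : ℝ} (hc : EpigraphChart U x₀ e ψ K r) (hΩ : MeasurableSet Ω) (hUΩ : U ⊆ Ω) :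
    ∃ C : ℝ≥0∞, C ≠ ⊤ ∧ ∀ φ : E d → ℝ, ContDiff ℝ ∞ φ →
      ∫⁻ x in frontier U ∩ Metric.ball x₀ (r / 2), ‖φ x‖ₑ ^ 2
          ∂Measure.euclideanHausdorffMeasure (d - 1) ≤
        C * ((∫⁻ x in Ω, ‖φ x‖ₑ ^ 2) + ∫⁻ x in Ω, ‖fderiv ℝ φ x‖ₑ ^ 2) := by
  set h : ℝ := r / 2 with hh
  have hr := hc.pos
  have hpos : 0 < h := by positivity
  set H : ℝ≥0∞ := ENNReal.ofReal h with hH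
  have hH0 : H ≠ 0 := by simpa [hH] using hpos
  have hHt : H ≠ ⊤ := ENNReal.ofReal_ne_top
  set L : ℝ≥0∞ := ((1 + K : ℝ≥0) : ℝ≥0∞) ^ (d - 1)
  have hL : L ≠ ⊤ := ENNReal.pow_ne_top ENNReal.coe_ne_top
  refine ⟨H⁻¹ * (L * (2 + 2 * H * H)), ENNReal.mul_ne_top (ENNReal.inv_ne_top.2 hH0)
    (by finiteness), fun φ hφ => ?_⟩
  set A : Set (E d) := frontier U ∩ Metric.ball x₀ h with hA
  have hAm : MeasurableSet A := isClosed_frontier.measurableSet.inter measurableSet_ball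
  have m1 := measurable_enorm_sq hφ
  have m2 := measurable_enorm_fderiv_sq hφ
  set F : E d → ℝ≥0∞ := fun x => 2 * ‖φ x‖ₑ ^ 2 + 2 * H * H * ‖fderiv ℝ φ x‖ₑ ^ 2 with hF
  have mF : Measurable F := (m1.const_mul _).add (m2.const_mul _)
  have mI : Measurable (Ω.indicator F) := mF.indicator hΩ
  have key : ∀ s ∈ A, H * ‖φ s‖ₑ ^ 2 ≤ ∫⁻ τ : ℝ, Ω.indicator F (s + τ • e) := by
    intro s hs
    refine le_trans ?_ (hc.setLIntegral_segment_le hUΩ F hs)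
    have hvol : ∀ c : ℝ≥0∞, ∫⁻ _ in Ioo 0 h, c = H * c := by
      intro c; rw [setLIntegral_const, Real.volume_Ioo, sub_zero, mul_comm]
    have m3 : Measurable fun τ : ℝ => ‖φ (s + τ • e)‖ₑ ^ 2 := m1.comp (by fun_prop)
    have m4 : Measurable fun τ : ℝ => ‖fderiv ℝ φ (s + τ • e)‖ₑ ^ 2 := m2.comp (by fun_prop)
    calc H * ‖φ s‖ₑ ^ 2 = ∫⁻ _ in Ioo 0 h, ‖φ s‖ₑ ^ 2 := (hvol _).symm
      _ ≤ ∫⁻ t in Ioo 0 h, (2 * ‖φ (s + t • e)‖ₑ ^ 2 +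
            2 * H * ∫⁻ τ in Ioo 0 h, ‖fderiv ℝ φ (s + τ • e)‖ₑ ^ 2) :=
          setLIntegral_mono' measurableSet_Ioo fun t ht =>
            (enorm_sq_le_of_segment hφ hc.norm_eq s ht).1
      _ = ∫⁻ t in Ioo 0 h, F (s + t • e) := by
          rw [lintegral_add_left (m3.const_mul _), hvol, hF,
            lintegral_add_left (m3.const_mul _), lintegral_const_mul _ m4]
          ring
  have e1 : H * ∫⁻ x in A, ‖φ x‖ₑ ^ 2 ∂Measure.euclideanHausdorffMeasure (d - 1) ≤
      L * ∫⁻ x in Ω, F x := by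
    rw [← lintegral_const_mul _ m1, ← lintegral_indicator hΩ,
      lintegral_eq_lintegral_graph hc.norm_eq hc.lip.continuous mI]
    calc _ ≤ ∫⁻ s in A, (∫⁻ τ : ℝ, Ω.indicator F (s + τ • e))
          ∂Measure.euclideanHausdorffMeasure (d - 1) := setLIntegral_mono' hAm key
      _ ≤ ∫⁻ s, (∫⁻ τ : ℝ, Ω.indicator F (s + τ • e))
          ∂(L • (volume : Measure (ℝ ∙ e)ᗮ).map (graphMap e ψ)) := by
          refine lintegral_mono' (hausdorff_restrict_le_map hc.norm_eq hc.lip ?_) le_rfl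
          exact (inter_subset_inter_right _ (Metric.ball_subset_ball (by linarith))).trans
            hc.frontier_subset_range
      _ = _ := by rw [lintegral_smul_measure, smul_eq_mul]
  have e2 : ∫⁻ x in Ω, F x ≤
      (2 + 2 * H * H) * ((∫⁻ x in Ω, ‖φ x‖ₑ ^ 2) + ∫⁻ x in Ω, ‖fderiv ℝ φ x‖ₑ ^ 2) := by
    rw [hF, lintegral_add_left (m1.const_mul _), lintegral_const_mul _ m1,
      lintegral_const_mul _ m2, mul_add]
    gcongr
    · exact le_self_add
    · exact le_add_self
  calc _ = H⁻¹ * (H * ∫⁻ x in A, ‖φ x‖ₑ ^ 2 ∂Measure.euclideanHausdorffMeasure (d - 1)) := by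
        rw [← mul_assoc, ENNReal.inv_mul_cancel hH0 hHt, one_mul]
    _ ≤ H⁻¹ * (L * ((2 + 2 * H * H) *
          ((∫⁻ x in Ω, ‖φ x‖ₑ ^ 2) + ∫⁻ x in Ω, ‖fderiv ℝ φ x‖ₑ ^ 2))) := by
        refine mul_le_mul_right ?_ _
        exact e1.trans (mul_le_mul_right e2 _)
    _ = _ := by ring

/-- A property of bounds that holds locally holds on compact sets. -/
theorem exists_bound_of_compact {X : Type*} [TopologicalSpace X] [MeasurableSpace X] {ι : Type*}
    {μ : Measure X} {f : ι → X → ℝ≥0∞} {Q : ι → ℝ≥0∞} {S : Set X} (hS : IsCompact S)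
    (hloc : ∀ x ∈ S, ∃ V ∈ 𝓝[S] x, ∃ C : ℝ≥0∞, C ≠ ⊤ ∧ ∀ i, ∫⁻ x in V, f i x ∂μ ≤ C * Q i) :
    ∃ C : ℝ≥0∞, C ≠ ⊤ ∧ ∀ i, ∫⁻ x in S, f i x ∂μ ≤ C * Q i := by
  refine hS.induction_on (p := fun A => ∃ C : ℝ≥0∞, C ≠ ⊤ ∧ ∀ i, ∫⁻ x in A, f i x ∂μ ≤ C * Q i)
    ⟨0, by simp, by simp⟩ ?_ ?_ hloc
  · rintro A B hAB ⟨C, hC, h⟩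
    exact ⟨C, hC, fun i => (lintegral_mono_set hAB).trans (h i)⟩
  · rintro A B ⟨C, hC, h⟩ ⟨C', hC', h'⟩
    refine ⟨C + C', by finiteness, fun i => ?_⟩
    rw [add_mul]
    exact (lintegral_union_le _ _ _).trans (add_le_add (h i) (h' i))

/-- The trace inequality on the boundary of a bounded Lipschitz open set `U ⊆ Ω`. -/
theorem exists_trace_bound {U Ω : Set (E d)} (hU : HasLipschitzBoundary U)
    (hUb : Bornology.IsBounded U) (hΩ : MeasurableSet Ω) (hUΩ : U ⊆ Ω) :
    ∃ C : ℝ≥0∞, C ≠ ⊤ ∧ ∀ φ : E d → ℝ, ContDiff ℝ ∞ φ →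
      ∫⁻ x in frontier U, ‖φ x‖ₑ ^ 2 ∂Measure.euclideanHausdorffMeasure (d - 1) ≤
        C * ((∫⁻ x in Ω, ‖φ x‖ₑ ^ 2) + ∫⁻ x in Ω, ‖fderiv ℝ φ x‖ₑ ^ 2) := by
  have hS : IsCompact (frontier U) :=
    Metric.isCompact_of_isClosed_isBounded isClosed_frontier
      (hUb.closure.subset frontier_subset_closure)
  obtain ⟨C, hC, h⟩ := exists_bound_of_compact (ι := {φ : E d → ℝ // ContDiff ℝ ∞ φ})
    (μ := Measure.euclideanHausdorffMeasure (d - 1)) (f := fun φ x => ‖φ.1 x‖ₑ ^ 2)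
    (Q := fun φ => (∫⁻ x in Ω, ‖φ.1 x‖ₑ ^ 2) + ∫⁻ x in Ω, ‖fderiv ℝ φ.1 x‖ₑ ^ 2) hS
    (fun x hx => by
      obtain ⟨e, ψ, K, r, hc⟩ := hU.exists_chart hx
      obtain ⟨C, hC, h⟩ := hc.exists_trace_bound hΩ hUΩ
      refine ⟨frontier U ∩ Metric.ball x (r / 2), inter_mem_nhdsWithin _
        (Metric.ball_mem_nhds _ (half_pos hc.pos)), C, hC, fun φ => h φ.1 φ.2⟩)
  exact ⟨C, hC, fun φ hφ => h ⟨φ, hφ⟩⟩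

/-! ### A Poincaré inequality with a boundary term -/

/-- The energy `∫_Ω |∇φ|² dx + ∫_S φ² ds`. -/
def energy (Ω S : Set (E d)) (φ : E d → ℝ) : ℝ≥0∞ :=
  (∫⁻ x in Ω, ‖fderiv ℝ φ x‖ₑ ^ 2) +
    ∫⁻ x in S, ‖φ x‖ₑ ^ 2 ∂Measure.euclideanHausdorffMeasure (d - 1)

/-- The `L²` norm on `A` of smooth functions is controlled by the energy. -/
def Controlled (Ω S A : Set (E d)) : Prop :=
  ∃ C : ℝ≥0∞, C ≠ ⊤ ∧ ∀ φ : E d → ℝ, ContDiff ℝ ∞ φ →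
    ∫⁻ x in A, ‖φ x‖ₑ ^ 2 ≤ C * energy Ω S φ

namespace Controlled

variable {Ω S A B : Set (E d)}

theorem mono (h : Controlled Ω S B) (hAB : A ⊆ B) : Controlled Ω S A := by
  obtain ⟨C, hC, h⟩ := h
  exact ⟨C, hC, fun φ hφ => (lintegral_mono_set hAB).trans (h φ hφ)⟩

theorem of_isCompact (hA : IsCompact A) (h : ∀ x ∈ A, ∃ V ∈ 𝓝 x, Controlled Ω S (V ∩ B)) :
    Controlled Ω S (A ∩ B) := by
  refine hA.induction_on (p := fun A => Controlled Ω S (A ∩ B)) ⟨0, by simp, by simp⟩ ?_ ?_ ?_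
  · exact fun s t hst ht => ht.mono (inter_subset_inter_left _ hst)
  · rintro s t ⟨C, hC, h⟩ ⟨C', hC', h'⟩
    refine ⟨C + C', by finiteness, fun φ hφ => ?_⟩
    rw [add_mul, union_inter_distrib_right]
    exact (lintegral_union_le _ _ _).trans (add_le_add (h φ hφ) (h' φ hφ))
  · intro x hx
    obtain ⟨V, hV, h⟩ := h x hx
    exact ⟨V, mem_nhdsWithin_of_mem_nhds hV, h⟩

/-- Control is transported by translations that sweep through `Ω`. -/
theorem of_translate (hA : MeasurableSet A) (hB : MeasurableSet B) (hΩ : MeasurableSet Ω)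
    (h : Controlled Ω S A) (v : E d) (hv : ∀ x ∈ B, x + v ∈ A)
    (hs : ∀ x ∈ B, ∀ t ∈ Ioo (0 : ℝ) 1, x + t • v ∈ Ω) : Controlled Ω S B := by
  obtain ⟨C, hC, h⟩ := h
  refine ⟨2 * C + 2 * ‖v‖ₑ ^ 2, by finiteness, fun φ hφ => ?_⟩
  have m1 := measurable_enorm_sq hφ
  have m2 := measurable_enorm_fderiv_sq hφ
  have m3 : Measurable fun p : E d × ℝ => ‖fderiv ℝ φ (p.1 + p.2 • v)‖ₑ ^ 2 := m2.comp (by fun_prop)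
  have m5 : Measurable fun x : E d => ‖φ (x + v)‖ₑ ^ 2 := m1.comp (by fun_prop)
  have key : ∀ x, ‖φ x‖ₑ ^ 2 ≤ 2 * ‖φ (x + v)‖ₑ ^ 2 +
      2 * ‖v‖ₑ ^ 2 * ∫⁻ τ in Ioo (0 : ℝ) 1, ‖fderiv ℝ φ (x + τ • v)‖ₑ ^ 2 := by
    intro x
    have h1 := enorm_sub_sq_le_lintegral hφ x v zero_le_one
    rw [one_smul, ENNReal.ofReal_one, one_mul, ← enorm_neg, neg_sub] at h1
    refine (enorm_sq_le_of_sub (φ x) (φ (x + v))).trans ?_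
    rw [mul_assoc]
    gcongr
  have e1 : ∫⁻ x in B, ‖φ (x + v)‖ₑ ^ 2 ≤ ∫⁻ x in A, ‖φ x‖ₑ ^ 2 := by
    rw [← lintegral_indicator hB, ← lintegral_indicator hA,
      ← lintegral_add_right_eq_self (A.indicator fun x => ‖φ x‖ₑ ^ 2) v]
    refine lintegral_mono fun x => ?_
    by_cases hx : x ∈ B
    · rw [indicator_of_mem hx, indicator_of_mem (hv x hx)]
    · rw [indicator_of_notMem hx]; exact zero_le
  have e2 : ∫⁻ x in B, (∫⁻ τ in Ioo (0 : ℝ) 1, ‖fderiv ℝ φ (x + τ • v)‖ₑ ^ 2) ≤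
      ∫⁻ x in Ω, ‖fderiv ℝ φ x‖ₑ ^ 2 := by
    rw [lintegral_lintegral_swap m3.aemeasurable]
    calc _ ≤ ∫⁻ _ in Ioo (0 : ℝ) 1, ∫⁻ x in Ω, ‖fderiv ℝ φ x‖ₑ ^ 2 := by
          refine setLIntegral_mono' measurableSet_Ioo fun τ hτ => ?_
          rw [← lintegral_indicator hB, ← lintegral_indicator hΩ,
            ← lintegral_add_right_eq_self (Ω.indicator fun x => ‖fderiv ℝ φ x‖ₑ ^ 2) (τ • v)]
          refine lintegral_mono fun x => ?_
          by_cases hx : x ∈ B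
          · rw [indicator_of_mem hx, indicator_of_mem (hs x hx τ hτ)]
          · rw [indicator_of_notMem hx]; exact zero_le
      _ = _ := by simp
  calc ∫⁻ x in B, ‖φ x‖ₑ ^ 2
      ≤ ∫⁻ x in B, (2 * ‖φ (x + v)‖ₑ ^ 2 +
        2 * ‖v‖ₑ ^ 2 * ∫⁻ τ in Ioo (0 : ℝ) 1, ‖fderiv ℝ φ (x + τ • v)‖ₑ ^ 2) := lintegral_mono key
    _ = 2 * (∫⁻ x in B, ‖φ (x + v)‖ₑ ^ 2) + 2 * ‖v‖ₑ ^ 2 *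
        ∫⁻ x in B, (∫⁻ τ in Ioo (0 : ℝ) 1, ‖fderiv ℝ φ (x + τ • v)‖ₑ ^ 2) := by
        rw [lintegral_add_left (m5.const_mul _), lintegral_const_mul _ m5,
          lintegral_const_mul _ m3.lintegral_prod_right']
    _ ≤ 2 * (C * energy Ω S φ) + 2 * ‖v‖ₑ ^ 2 * energy Ω S φ := by
        refine add_le_add (mul_le_mul_right (e1.trans (h φ hφ)) _)
          (mul_le_mul_right (e2.trans le_self_add) _)
    _ = _ := by ring

end Controlled

/-- Points near the boundary of `U` and on the inner side of it have controlled neighbourhoods. -/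
theorem EpigraphChart.exists_controlled {U Ω : Set (E d)} {x₀ e : E d} {ψ : (ℝ ∙ e)ᗮ → ℝ}
    {K : ℝ≥0} {r : ℝ} (hc : EpigraphChart U x₀ e ψ K r) (hx₀ : x₀ ∈ frontier U)
    (hΩ : MeasurableSet Ω) (hUΩ : U ⊆ Ω) :
    ∃ x ∈ U, ∃ V ∈ 𝓝 x, Controlled Ω (frontier U) V := by
  set h : ℝ := r / 2 with hh
  have hr := hc.pos
  have hpos : 0 < h := by positivity
  set H : ℝ≥0∞ := ENNReal.ofReal h with hH
  set P : E d → (ℝ ∙ e)ᗮ := fun x => (ℝ ∙ e)ᗮ.orthogonalProjectionOnto x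
  set V : Set (E d) := {x | graphMap e ψ (P x) ∈ Metric.ball x₀ h} ∩
    {x | ⟪e, x⟫ - ψ (P x) ∈ Ioo 0 h} with hV
  have hgc : Continuous (graphMap e ψ) := continuous_graphMap hc.lip.continuous
  have hVo : IsOpen V := (Metric.isOpen_ball.preimage (hgc.comp continuous_proj)).inter
    (isOpen_Ioo.preimage hc.continuous_height)
  have hx₀B : x₀ ∈ Metric.ball x₀ h := Metric.mem_ball_self hpos
  refine ⟨x₀ + (h / 2) • e, hc.add_smul_mem hx₀ hx₀B ⟨by positivity, by rw [← hh]; linarith⟩, V,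
    hVo.mem_nhds ⟨?_, ?_⟩, ?_⟩
  · have h1 := graphMap_proj_add (ψ := ψ) hc.norm_eq x₀
    rw [(hc.mem_frontier_iff (Metric.mem_ball_self hr)).1 hx₀, sub_self, zero_smul, add_zero] at h1
    change graphMap e ψ (P (x₀ + (h / 2) • e)) ∈ Metric.ball x₀ h
    simp only [P, proj_add_smul, h1, hx₀B]
  · simp only [mem_ofPred_eq, P, proj_add_smul, inner_add_right, inner_smul_right,
      real_inner_self_eq_norm_sq, hc.norm_eq,
      (hc.mem_frontier_iff (Metric.mem_ball_self hr)).1 hx₀]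
    constructor <;> linarith
  refine ⟨2 * H + 2 * H * H, by finiteness, fun φ hφ => ?_⟩
  have m1 := measurable_enorm_sq hφ
  have m2 := measurable_enorm_fderiv_sq hφ
  set A : Set (E d) := frontier U ∩ Metric.ball x₀ h with hA
  have hAm : MeasurableSet A := isClosed_frontier.measurableSet.inter measurableSet_ball
  have mD : Measurable (Ω.indicator fun x => ‖fderiv ℝ φ x‖ₑ ^ 2) := m2.indicator hΩ
  have mD2 : Measurable fun x : E d =>
      ∫⁻ τ : ℝ, Ω.indicator (fun x => ‖fderiv ℝ φ x‖ₑ ^ 2) (x + τ • e) := by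
    have : Measurable fun p : E d × ℝ =>
      Ω.indicator (fun x => ‖fderiv ℝ φ x‖ₑ ^ 2) (p.1 + p.2 • e) := mD.comp (by fun_prop)
    exact this.lintegral_prod_right'
  set ν := (volume : Measure (ℝ ∙ e)ᗮ).map (graphMap e ψ) with hν
  -- the integral over the line through a point of the graph
  have key : ∀ y, ∫⁻ t : ℝ, V.indicator (fun x => ‖φ x‖ₑ ^ 2) (graphMap e ψ y + t • e) ≤
      A.indicator (fun x => 2 * H * ‖φ x‖ₑ ^ 2) (graphMap e ψ y) + 2 * H * H *
        ∫⁻ τ : ℝ, Ω.indicator (fun x => ‖fderiv ℝ φ x‖ₑ ^ 2) (graphMap e ψ y + τ • e) := by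
    intro y
    set s := graphMap e ψ y with hs
    have hVs : ∀ t : ℝ, s + t • e ∈ V ↔ s ∈ Metric.ball x₀ h ∧ t ∈ Ioo 0 h := by
      intro t
      simp only [hV, P, mem_inter_iff, mem_ofPred_eq, hs, proj_graphMap_add,
        inner_graphMap_add hc.norm_eq, add_sub_cancel_left]
    by_cases hsB : s ∈ Metric.ball x₀ h
    · have hsf : s ∈ frontier U := by
        refine (hc.mem_frontier_iff (Metric.ball_subset_ball (by linarith) hsB)).2 ?_
        have := inner_graphMap_add (ψ := ψ) hc.norm_eq y 0
        rw [zero_smul, add_zero, add_zero] at this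
        rw [hs, proj_graphMap, this]
      rw [indicator_of_mem (show s ∈ A from ⟨hsf, hsB⟩)]
      calc ∫⁻ t : ℝ, V.indicator (fun x => ‖φ x‖ₑ ^ 2) (s + t • e)
          = ∫⁻ t in Ioo 0 h, ‖φ (s + t • e)‖ₑ ^ 2 := by
            rw [← lintegral_indicator measurableSet_Ioo]
            refine lintegral_congr fun t => ?_
            by_cases ht : t ∈ Ioo 0 h
            · rw [indicator_of_mem ht, indicator_of_mem ((hVs t).2 ⟨hsB, ht⟩)]
            · rw [indicator_of_notMem ht, indicator_of_notMem fun h => ht ((hVs t).1 h).2]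
        _ ≤ ∫⁻ _ in Ioo 0 h, (2 * ‖φ s‖ₑ ^ 2 +
              2 * H * ∫⁻ τ in Ioo 0 h, ‖fderiv ℝ φ (s + τ • e)‖ₑ ^ 2) :=
            setLIntegral_mono' measurableSet_Ioo fun t ht =>
              (enorm_sq_le_of_segment hφ hc.norm_eq s ht).2
        _ = 2 * H * ‖φ s‖ₑ ^ 2 +
              2 * H * H * ∫⁻ τ in Ioo 0 h, ‖fderiv ℝ φ (s + τ • e)‖ₑ ^ 2 := by
            rw [setLIntegral_const, Real.volume_Ioo, sub_zero]
            ring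
        _ ≤ _ := by
            refine add_le_add_right (mul_le_mul_right ?_ _) _
            exact hc.setLIntegral_segment_le hUΩ (fun x => ‖fderiv ℝ φ x‖ₑ ^ 2) ⟨hsf, hsB⟩
    · have : ∀ t : ℝ, V.indicator (fun x => ‖φ x‖ₑ ^ 2) (s + t • e) = 0 := fun t =>
        indicator_of_notMem (fun h => hsB ((hVs t).1 h).1) _
      simp [this]
  have mV : Measurable (V.indicator fun x => ‖φ x‖ₑ ^ 2) := m1.indicator hVo.measurableSet
  have mV2 : Measurable fun x : E d =>
      ∫⁻ t : ℝ, V.indicator (fun x => ‖φ x‖ₑ ^ 2) (x + t • e) := by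
    have : Measurable fun p : E d × ℝ => V.indicator (fun x => ‖φ x‖ₑ ^ 2) (p.1 + p.2 • e) :=
      mV.comp (by fun_prop)
    exact this.lintegral_prod_right'
  have mA : Measurable (A.indicator fun x => 2 * H * ‖φ x‖ₑ ^ 2) := (m1.const_mul _).indicator hAm
  calc ∫⁻ x in V, ‖φ x‖ₑ ^ 2
      = ∫⁻ x, (∫⁻ t : ℝ, V.indicator (fun x => ‖φ x‖ₑ ^ 2) (x + t • e)) ∂ν := by
        rw [← lintegral_indicator hVo.measurableSet,
          lintegral_eq_lintegral_graph hc.norm_eq hc.lip.continuous mV]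
    _ ≤ ∫⁻ x, (A.indicator (fun x => 2 * H * ‖φ x‖ₑ ^ 2) x + 2 * H * H *
        ∫⁻ τ : ℝ, Ω.indicator (fun x => ‖fderiv ℝ φ x‖ₑ ^ 2) (x + τ • e)) ∂ν := by
        have mG := mA.add (mD2.const_mul (2 * H * H))
        rw [hν, lintegral_map mV2 hgc.measurable]
        refine le_trans ?_ (lintegral_map mG hgc.measurable).ge
        exact lintegral_mono key
    _ = 2 * H * (∫⁻ x in A, ‖φ x‖ₑ ^ 2 ∂ν) + 2 * H * H * ∫⁻ x in Ω, ‖fderiv ℝ φ x‖ₑ ^ 2 := by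
        rw [lintegral_add_left mA, lintegral_const_mul _ mD2, hν,
          ← lintegral_eq_lintegral_graph hc.norm_eq hc.lip.continuous mD, lintegral_indicator hΩ,
          lintegral_indicator hAm, lintegral_const_mul _ m1]
    _ ≤ 2 * H * energy Ω (frontier U) φ + 2 * H * H * energy Ω (frontier U) φ := by
        refine add_le_add (mul_le_mul_right ?_ _) (mul_le_mul_right le_self_add _)
        refine le_trans ?_ le_add_self
        exact lintegral_mono' (Measure.restrict_mono inter_subset_left
          (map_graphMap_le hc.norm_eq hc.lip.continuous)) le_rfl
    _ = _ := by ring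

/-- Poincaré inequality: on a bounded Lipschitz domain `Ω` the `L²` norm is controlled by the
gradient and by the values on a Lipschitz hypersurface `∂U`, `U ⊆ Ω`. Controlled neighbourhoods
exist near `∂U`; they spread over the connected set `Ω` by translations, and up to the boundary by
translation along the inner directions of the charts. -/
theorem controlled_of_lipschitz {U Ω : Set (E d)} (hΩo : IsOpen Ω) (hΩc : IsPreconnected Ω)
    (hΩb : Bornology.IsBounded Ω) (hΩl : HasLipschitzBoundary Ω) (hU : HasLipschitzBoundary U)
    (hUf : (frontier U).Nonempty) (hUΩ : U ⊆ Ω) : Controlled Ω (frontier U) Ω := by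
  have hΩm := hΩo.measurableSet
  set W : Set (E d) := {x | ∃ V ∈ 𝓝 x, Controlled Ω (frontier U) V} with hW
  have hWo : IsOpen W := by
    refine isOpen_iff_mem_nhds.2 ?_
    rintro x ⟨V, hV, h⟩
    filter_upwards [eventually_mem_nhds_iff.2 hV] with z hz
    exact ⟨V, hz, h⟩
  have hsub : Ω ⊆ W := by
    refine hΩc.subset_of_closure_inter_subset hWo ?_ ?_
    · obtain ⟨x₀, hx₀⟩ := hUf
      obtain ⟨e, ψ, K, r, hc⟩ := hU.exists_chart hx₀
      obtain ⟨x, hx, h⟩ := hc.exists_controlled hx₀ hΩm hUΩ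
      exact ⟨x, hUΩ hx, h⟩
    · rintro x ⟨hxW, hx⟩
      obtain ⟨ρ, hρ, hball⟩ := Metric.isOpen_iff.1 hΩo x hx
      obtain ⟨y, ⟨V, hV, h⟩, hy⟩ := Metric.mem_closure_iff.1 hxW (ρ / 2) (half_pos hρ)
      obtain ⟨δ, hδ, hδV⟩ := Metric.mem_nhds_iff.1 hV
      have hδ' : 0 < min δ (ρ / 2) := lt_min hδ (half_pos hρ)
      refine ⟨Metric.ball x (min δ (ρ / 2)), Metric.ball_mem_nhds _ hδ', ?_⟩
      refine (h.mono hδV).of_translate measurableSet_ball measurableSet_ball hΩm (y - x) ?_ ?_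
      · intro z hz
        rw [mem_ball_iff_norm] at hz ⊢
        have : z + (y - x) - y = z - x := by abel
        rw [this]
        exact hz.trans_le (min_le_left _ _)
      · intro z hz t ht
        refine hball ?_
        rw [mem_ball_iff_norm] at hz ⊢
        have hyx : ‖y - x‖ < ρ / 2 := by rwa [← dist_eq_norm, dist_comm]
        calc ‖z + t • (y - x) - x‖ = ‖(z - x) + t • (y - x)‖ := by congr 1; abel
          _ ≤ ‖z - x‖ + ‖t • (y - x)‖ := norm_add_le _ _
          _ ≤ ‖z - x‖ + 1 * ‖y - x‖ := by
            rw [norm_smul, Real.norm_of_nonneg ht.1.le]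
            gcongr
            exact ht.2.le
          _ < ρ := by linarith [min_le_right δ (ρ / 2)]
  have hcpt : ∀ A : Set (E d), IsCompact A → A ⊆ Ω → Controlled Ω (frontier U) A := by
    intro A hA hAΩ
    have h := Controlled.of_isCompact (Ω := Ω) (S := frontier U) (B := univ) hA fun x hx => by
      obtain ⟨V, hV, h⟩ := hsub (hAΩ hx)
      exact ⟨V, hV, by simpa using h⟩
    simpa using h
  have hclos : IsCompact (closure Ω) := hΩb.isCompact_closure
  have h := Controlled.of_isCompact (Ω := Ω) (S := frontier U) (B := Ω) hclos fun x hx => by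
    by_cases hxΩ : x ∈ Ω
    · obtain ⟨V, hV, h⟩ := hsub hxΩ
      exact ⟨V, hV, h.mono inter_subset_left⟩
    have hxf : x ∈ frontier Ω := ⟨hx, by rwa [hΩo.interior_eq]⟩
    obtain ⟨e, ψ, K, r, hc⟩ := hΩl.exists_chart hxf
    have hr := hc.pos
    refine ⟨Metric.ball x (r / 3), Metric.ball_mem_nhds _ (by positivity), ?_⟩
    set B := Metric.ball x (r / 3) ∩ Ω with hB
    set v : E d := (r / 6) • e with hv
    set A : Set (E d) := closure ((fun z => z + v) '' B) with hA
    have hBb : Bornology.IsBounded B := Metric.isBounded_ball.subset inter_subset_left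
    have hAc : IsCompact A := by
      refine Bornology.IsBounded.isCompact_closure ?_
      refine (LipschitzWith.isBounded_image (K := 1) ?_ hBb)
      exact LipschitzWith.of_dist_le_mul fun a b => by simp
    have hAΩ : A ⊆ Ω := by
      intro z hz
      have hpos : 0 < (1 + K : ℝ)⁻¹ * (r / 6) := by positivity
      obtain ⟨_, ⟨w, hw, rfl⟩, hzw⟩ := Metric.mem_closure_iff.1 hz _ hpos
      exact hc.closedBall_subset hw.2 hw.1 ⟨by positivity, by linarith⟩ hzw.le
    refine (hcpt A hAc hAΩ).of_translate isClosed_closure.measurableSet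
      (measurableSet_ball.inter hΩm) hΩm v (fun z hz => subset_closure ⟨z, hz, rfl⟩) ?_
    intro z hz t ht
    rw [hv, smul_smul]
    have ht0 : 0 < t * (r / 6) := mul_pos ht.1 (by positivity)
    have ht1 : t * (r / 6) < r / 3 := by nlinarith [ht.2]
    refine hc.closedBall_subset hz.2 hz.1 ⟨ht0, ht1⟩ (Metric.mem_closedBall_self (by positivity))
  rwa [inter_eq_right.2 subset_closure] at h

/-! ### Mollification -/

section Mollify

variable {F : Type*} [NormedAddCommGroup F] [NormedSpace ℝ F]

/-- The convolution `k ⋆ f` of `f` with the scalar kernel `k`. -/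
def mollify (k : E d → ℝ) (f : E d → F) (x : E d) : F := ∫ z, k (x - z) • f z

theorem mollify_eq (k : E d → ℝ) (f : E d → F) (x : E d) :
    mollify k f x = ∫ t, k t • f (x - t) := by
  rw [mollify, ← integral_sub_left_eq_self _ volume x]
  simp

theorem mollify_eq_convolution (k : E d → ℝ) (f : E d → F) :
    mollify k f = convolution f k (ContinuousLinearMap.lsmul ℝ ℝ).flip volume := by
  ext x; rfl

theorem eLpNorm_two_sq {α G : Type*} [MeasurableSpace α] [NormedAddCommGroup G] {μ : Measure α}
    (f : α → G) :
    eLpNorm f 2 μ ^ 2 = ∫⁻ x, ‖f x‖ₑ ^ 2 ∂μ := by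
  have h := eLpNorm_nnreal_pow_eq_lintegral (f := f) (μ := μ) (p := 2) (by simp)
  simpa using h

/-- Translations act continuously on `L²`. -/
theorem tendsto_eLpNorm_translate {G : Type*} [NormedAddCommGroup G] {f : E d → G}
    (hf : MemLp f 2 volume) :
    Tendsto (fun t : E d => eLpNorm (fun x => f (x - t) - f x) 2 volume) (𝓝 0) (𝓝 0) := by
  let g : E d → C(E d, E d) := fun t => ⟨fun x => x - t, by fun_prop⟩
  have hg : Continuous g :=
    ContinuousMap.continuous_of_continuous_uncurry _ (continuous_snd.sub continuous_fst)
  have hgm : ∀ t, MeasurePreserving (g t) (volume : Measure (E d)) volume := fun t =>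
    measurePreserving_sub_right volume t
  have h := (tendsto_const_nhds (x := hf.toLp f) (f := 𝓝 (0 : E d))).compMeasurePreservingLp
    (hg.tendsto 0) hgm (hgm 0) (by simp)
  simp only [Lp.toLp_compMeasurePreserving] at h
  rw [Lp.tendsto_Lp_iff_tendsto_eLpNorm''] at h
  refine h.congr fun t => ?_
  congr 1
  ext x
  simp [g]

/-- Mollifying with a probability density moves `f` in `L²` by no more than the translations by
vectors in the support of the density do. -/
theorem lintegral_mollify_sub_le [CompleteSpace F] {f : E d → F} (hfm : StronglyMeasurable f)
    (hf : MemLp f 2 volume) {k : E d → ℝ} (hk : Continuous k) (hkc : HasCompactSupport k)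
    (hk0 : ∀ x, 0 ≤ k x) (hk1 : ∫ x, k x = 1) {ε : ℝ≥0∞}
    (hε : ∀ t, k t ≠ 0 → ∫⁻ x, ‖f (x - t) - f x‖ₑ ^ 2 ≤ ε) :
    ∫⁻ x, ‖mollify k f x - f x‖ₑ ^ 2 ≤ ε := by
  have hki : Integrable k := hk.integrable_of_hasCompactSupport hkc
  have hkl : ∫⁻ t, ENNReal.ofReal (k t) = 1 := by
    rw [← ofReal_integral_eq_lintegral_ofReal hki (ae_of_all _ hk0), hk1, ENNReal.ofReal_one]
  have hkm : Measurable fun t => ENNReal.ofReal (k t) := hk.measurable.ennreal_ofReal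
  have hloc : LocallyIntegrable f := hf.locallyIntegrable (by norm_num)
  have hfm2 : StronglyMeasurable fun p : E d × E d => f (p.1 - p.2) - f p.1 :=
    (hfm.comp_measurable (by fun_prop)).sub (hfm.comp_measurable (by fun_prop))
  have hm : Measurable fun p : E d × E d => ‖f (p.1 - p.2) - f p.1‖ₑ ^ 2 :=
    hfm2.enorm.pow_const 2
  have key : ∀ x, ‖mollify k f x - f x‖ₑ ^ 2 ≤
      ∫⁻ t, ENNReal.ofReal (k t) * ‖f (x - t) - f x‖ₑ ^ 2 := by
    intro x
    have hi : Integrable fun t => k t • f (x - t) :=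
      hkc.convolutionExists_left (ContinuousLinearMap.lsmul ℝ ℝ) hk hloc x
    have h1 : mollify k f x - f x = ∫ t, k t • (f (x - t) - f x) := by
      simp only [smul_sub]
      rw [integral_sub hi (hki.smul_const _), integral_smul_const, hk1, one_smul, mollify_eq]
    have hmx : Measurable fun t => ‖f (x - t) - f x‖ₑ :=
      (hfm2.comp_measurable (measurable_prodMk_left (x := x))).enorm
    calc ‖mollify k f x - f x‖ₑ ^ 2
        ≤ (∫⁻ t, ENNReal.ofReal (k t) * ‖f (x - t) - f x‖ₑ) ^ 2 := by
          rw [h1]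
          refine pow_le_pow_left₀ zero_le ((enorm_integral_le_lintegral_enorm _).trans_eq ?_) 2
          refine lintegral_congr fun t => ?_
          rw [enorm_smul, Real.enorm_of_nonneg (hk0 t)]
      _ = (∫⁻ t, ‖f (x - t) - f x‖ₑ ∂(volume.withDensity fun t => ENNReal.ofReal (k t))) ^ 2 := by
          rw [lintegral_withDensity_eq_lintegral_mul _ hkm hmx]; rfl
      _ ≤ _ := lintegral_sq_le hmx.aemeasurable
      _ = _ := by
          rw [lintegral_withDensity_eq_lintegral_mul _ hkm (hmx.pow_const 2),
            withDensity_apply _ MeasurableSet.univ, Measure.restrict_univ, hkl, one_mul]; rfl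
  calc ∫⁻ x, ‖mollify k f x - f x‖ₑ ^ 2
      ≤ ∫⁻ x, ∫⁻ t, ENNReal.ofReal (k t) * ‖f (x - t) - f x‖ₑ ^ 2 := lintegral_mono key
    _ = ∫⁻ t, ∫⁻ x, ENNReal.ofReal (k t) * ‖f (x - t) - f x‖ₑ ^ 2 := by
        refine lintegral_lintegral_swap (Measurable.aemeasurable ?_)
        exact (hkm.comp measurable_snd).mul hm
    _ ≤ ∫⁻ t, ENNReal.ofReal (k t) * ε := by
        refine lintegral_mono fun t => ?_
        rw [lintegral_const_mul' _ _ ENNReal.ofReal_ne_top]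
        by_cases ht : k t = 0
        · simp [ht]
        · exact mul_le_mul_right (hε t ht) _
    _ = ε := by rw [lintegral_mul_const _ hkm, hkl, one_mul]

/-- Approximate identities whose supports shrink to the origin, without necessarily containing it,
converge in `L²`. -/
theorem tendsto_mollify [CompleteSpace F] {f : E d → F} (hfm : StronglyMeasurable f)
    (hf : MemLp f 2 volume) {k : ℕ → E d → ℝ} (hk : ∀ n, Continuous (k n))
    (hkc : ∀ n, HasCompactSupport (k n)) (hk0 : ∀ n x, 0 ≤ k n x) (hk1 : ∀ n, ∫ x, k n x = 1)
    {ρ : ℕ → ℝ} (hρ : Tendsto ρ atTop (𝓝 0)) (hks : ∀ n t, k n t ≠ 0 → ‖t‖ ≤ ρ n) :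
    Tendsto (fun n => eLpNorm (fun x => mollify (k n) f x - f x) 2 volume) atTop (𝓝 0) := by
  rw [ENNReal.tendsto_nhds_zero]
  intro ε hε
  have h := ENNReal.tendsto_nhds_zero.1 (tendsto_eLpNorm_translate hf) ε hε
  obtain ⟨δ, hδ, h⟩ := Metric.eventually_nhds_iff_ball.1 h
  filter_upwards [hρ.eventually (gt_mem_nhds hδ)] with n hn
  have h1 : eLpNorm (fun x => mollify (k n) f x - f x) 2 volume ^ 2 ≤ ε ^ 2 := by
    rw [eLpNorm_two_sq]
    refine lintegral_mollify_sub_le hfm hf (hk n) (hkc n) (hk0 n) (hk1 n) fun t ht => ?_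
    rw [← eLpNorm_two_sq]
    exact pow_le_pow_left₀ zero_le (h t (mem_ball_zero_iff.2 ((hks n t ht).trans_lt hn))) 2
  exact (ENNReal.pow_le_pow_left_iff two_ne_zero).1 h1

theorem contDiff_mollify {f : E d → F} (hf : LocallyIntegrable f) {k : E d → ℝ}
    (hk : ContDiff ℝ ∞ k) (hkc : HasCompactSupport k) : ContDiff ℝ ∞ (mollify k f) := by
  rw [mollify_eq_convolution]
  exact hkc.contDiff_convolution_right _ hf hk

end Mollify

/-- Functions on `Ω` are extended by zero to the whole space. -/
theorem memLp_indicator_coe {F : Type*} [NormedAddCommGroup F] {Ω : Set (E d)}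
    (hΩ : MeasurableSet Ω) (f : Lp F 2 (volume.restrict Ω)) : MemLp (Ω.indicator f) 2 volume :=
  (memLp_indicator_iff_restrict hΩ).2 (Lp.memLp f)

/-- Where the kernel only sees `Ω`, the gradient of the mollification is the mollification of the
weak gradient. -/
theorem gradient_mollify {Ω : Set (E d)} (hΩ : MeasurableSet Ω) (u : H1 Ω) {k : E d → ℝ}
    (hk : ContDiff ℝ ∞ k) (hkc : HasCompactSupport k) {x : E d}
    (hx : ∀ t ∈ tsupport k, x - t ∈ Ω) :
    gradient (mollify k (Ω.indicator (toL2 u))) x = mollify k (Ω.indicator (grad u)) x := by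
  have hloc : LocallyIntegrable (Ω.indicator (toL2 u)) :=
    (memLp_indicator_coe hΩ _).locallyIntegrable (by norm_num)
  set η : E d → ℝ := fun z => k (x - z) with hη
  have hηs : ContDiff ℝ ∞ η := hk.comp (contDiff_const.sub contDiff_id)
  have hηc : HasCompactSupport η := hkc.comp_homeomorph (Homeomorph.subLeft x)
  have hηt : tsupport η ⊆ Ω := by
    intro z hz
    have h : x - z ∈ tsupport k := by
      have hc : Continuous fun z : E d => x - z := by fun_prop
      exact hc.closure_preimage_subset (Function.support k) hz
    simpa using hx _ h
  have hηd : ∀ z y, fderiv ℝ η z y = - fderiv ℝ k (x - z) y := by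
    intro z y
    have h1 : HasFDerivAt (fun z : E d => x - z) (-ContinuousLinearMap.id ℝ (E d)) z := by
      simpa using (hasFDerivAt_id (𝕜 := ℝ) z).const_sub x
    have h2 := ((hk.differentiable (by simp) (x - z)).hasFDerivAt).comp z h1
    rw [HasFDerivAt.fderiv (f := η) h2]
    simp
  refine ext_inner_right ℝ fun y => ?_
  have h1 : ⟪gradient (mollify k (Ω.indicator (toL2 u))) x, y⟫ =
      fderiv ℝ (mollify k (Ω.indicator (toL2 u))) x y := by
    rw [gradient, InnerProductSpace.toDual_symm_apply]
  have h2 : fderiv ℝ (mollify k (Ω.indicator (toL2 u))) x y =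
      ∫ z, fderiv ℝ k (x - z) y * Ω.indicator (toL2 u) z := by
    rw [mollify_eq_convolution, (hkc.hasFDerivAt_convolution_right _ hloc
      (hk.of_le (by simp)) x).fderiv, convolution_precompR_apply _ hloc (hkc.fderiv ℝ)
      (hk.continuous_fderiv (by simp))]
    rfl
  have h3 : ∀ g : E d → ℝ, ∀ w : E d → ℝ,
      ∫ z, g z * Ω.indicator w z = ∫ z in Ω, w z * g z := by
    intro g w
    rw [← integral_indicator hΩ]
    refine integral_congr_ae (ae_of_all _ fun z => ?_)
    by_cases hz : z ∈ Ω
    · simp [hz, mul_comm]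
    · simp [hz]
  have h4 := u.2 η hηs hηc hηt y
  have h5 : Integrable fun z => η z • Ω.indicator (grad u) z := by
    have := (integrable_indicator_iff hΩ).2 (integrable_smul_test (grad u) hηs.continuous hηc)
    refine this.congr (ae_of_all _ fun z => ?_)
    by_cases hz : z ∈ Ω <;> simp [hz]
  rw [h1, h2, h3]
  have h6 : ⟪mollify k (Ω.indicator (grad u)) x, y⟫ = ∫ z in Ω, η z * ⟪grad u z, y⟫ := by
    rw [mollify, real_inner_comm, ← integral_inner h5, ← integral_indicator hΩ]
    refine integral_congr_ae (ae_of_all _ fun z => ?_)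
    by_cases hz : z ∈ Ω
    · simp [hz, inner_smul_right, real_inner_comm]
    · simp [hz]
  rw [h6]
  simp only [hηd, mul_neg] at h4
  rw [integral_neg, neg_inj] at h4
  exact h4

/-! ### Density of smooth functions -/

/-- Small translations in a suitable direction `e` push the part of a Lipschitz domain near a given
point of its closure into the interior, at a distance to the complement proportional to the length
of the translation; near interior points `e = 0` will do. -/
theorem exists_inward {Ω : Set (E d)} (hΩ : IsOpen Ω) (hl : HasLipschitzBoundary Ω) {x : E d}
    (hx : x ∈ closure Ω) : ∃ (e : E d) (r c τ₀ : ℝ), 0 < r ∧ 0 < c ∧ 0 < τ₀ ∧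
      ∀ y ∈ Ω ∩ Metric.ball x r, ∀ τ ∈ Ioo 0 τ₀, Metric.closedBall (y + τ • e) (c * τ) ⊆ Ω := by
  by_cases hxΩ : x ∈ Ω
  · obtain ⟨ρ, hρ, hball⟩ := Metric.isOpen_iff.1 hΩ x hxΩ
    refine ⟨0, ρ / 2, 1, ρ / 2, by positivity, one_pos, by positivity, ?_⟩
    rintro y ⟨-, hy⟩ τ hτ z hz
    refine hball ?_
    rw [smul_zero, add_zero, one_mul, Metric.mem_closedBall] at hz
    rw [Metric.mem_ball] at hy ⊢
    linarith [dist_triangle z y x, hτ.2]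
  · obtain ⟨e, ψ, K, r, hc⟩ := hl.exists_chart (x₀ := x) ⟨hx, by rwa [hΩ.interior_eq]⟩
    have hr := hc.pos
    exact ⟨e, r / 3, (1 + K : ℝ)⁻¹, r / 3, by positivity, by positivity, by positivity,
      fun y hy τ hτ => hc.closedBall_subset hy.1 hy.2 hτ⟩

/-- Near each point of the closure of a Lipschitz domain, functions of `H¹(Ω)` are approximated by
smooth ones: mollify with kernels supported near `-τ e`, where `e` points into the domain. -/
theorem exists_local_approx {Ω : Set (E d)} (hΩ : IsOpen Ω) (hl : HasLipschitzBoundary Ω) {x : E d}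
    (hx : x ∈ closure Ω) (u : H1 Ω) : ∃ r : ℝ, 0 < r ∧ ∃ w : ℕ → E d → ℝ,
      (∀ n, ContDiff ℝ ∞ (w n)) ∧
      Tendsto (fun n => eLpNorm (fun y => w n y - toL2 u y) 2 (volume.restrict Ω)) atTop (𝓝 0) ∧
      Tendsto (fun n => eLpNorm (fun y => gradient (w n) y - grad u y) 2
        (volume.restrict (Ω ∩ Metric.ball x r))) atTop (𝓝 0) := by
  obtain ⟨e, r, c, τ₀, hr, hc, hτ₀, hin⟩ := exists_inward hΩ hl hx
  have hΩm := hΩ.measurableSet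
  set τ : ℕ → ℝ := fun n => τ₀ / (n + 2) with hτ
  have hτpos : ∀ n, 0 < τ n := fun n => by positivity
  have hτlt : ∀ n, τ n < τ₀ := fun n =>
    div_lt_self hτ₀ (by linarith [(Nat.cast_nonneg n : (0 : ℝ) ≤ n)])
  have hτ0 : Tendsto τ atTop (𝓝 0) :=
    tendsto_const_nhds.div_atTop (tendsto_atTop_add_const_right _ _ tendsto_natCast_atTop_atTop)
  set b : ∀ n, ContDiffBump (-(τ n • e)) := fun n =>
    ⟨c * τ n / 2, c * τ n, by have := hτpos n; positivity,
      half_lt_self (mul_pos hc (hτpos n))⟩ with hb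
  set k : ℕ → E d → ℝ := fun n => (b n).normed volume with hk
  have hks : ∀ n t, t ∈ tsupport (k n) → t ∈ Metric.closedBall (-(τ n • e)) (c * τ n) := by
    intro n t ht
    rwa [hk, (b n).tsupport_normed_eq] at ht
  have hkn : ∀ n t, k n t ≠ 0 → ‖t‖ ≤ τ n * (‖e‖ + c) := by
    intro n t ht
    have h := hks n t (subset_tsupport _ ht)
    rw [mem_closedBall_iff_norm, sub_neg_eq_add] at h
    calc ‖t‖ = ‖(t + τ n • e) - τ n • e‖ := by rw [add_sub_cancel_right]
      _ ≤ ‖t + τ n • e‖ + ‖τ n • e‖ := norm_sub_le _ _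
      _ ≤ c * τ n + τ n * ‖e‖ := by
        rw [norm_smul, Real.norm_of_nonneg (hτpos n).le]
        gcongr
      _ = _ := by ring
  have hρ : Tendsto (fun n => τ n * (‖e‖ + c)) atTop (𝓝 0) := by
    simpa using hτ0.mul_const (‖e‖ + c)
  have hsm : ∀ n, ContDiff ℝ ∞ (k n) := fun n => (b n).contDiff_normed
  have hcs : ∀ n, HasCompactSupport (k n) := fun n => (b n).hasCompactSupport_normed
  have hk0 : ∀ n t, 0 ≤ k n t := fun n t => (b n).nonneg_normed t
  have hk1 : ∀ n, ∫ t, k n t = 1 := fun n => (b n).integral_normed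
  have hu := memLp_indicator_coe hΩm (toL2 u)
  have hG := memLp_indicator_coe hΩm (grad u)
  have hum : StronglyMeasurable (Ω.indicator (toL2 u)) := (Lp.stronglyMeasurable _).indicator hΩm
  have hGm : StronglyMeasurable (Ω.indicator (grad u)) := (Lp.stronglyMeasurable _).indicator hΩm
  refine ⟨r, hr, fun n => mollify (k n) (Ω.indicator (toL2 u)), fun n =>
    contDiff_mollify (hu.locallyIntegrable (by norm_num)) (hsm n) (hcs n), ?_, ?_⟩
  · refine tendsto_of_tendsto_of_tendsto_of_le_of_le tendsto_const_nhds
      (tendsto_mollify hum hu (fun n => (hsm n).continuous) hcs hk0 hk1 hρ hkn)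
      (fun n => zero_le) (fun n => ?_)
    refine le_trans (eLpNorm_congr_ae ?_).le (eLpNorm_restrict_le _ _ _ Ω)
    filter_upwards [ae_restrict_mem hΩm] with y hy
    rw [indicator_of_mem hy]
  · refine tendsto_of_tendsto_of_tendsto_of_le_of_le tendsto_const_nhds
      (tendsto_mollify hGm hG (fun n => (hsm n).continuous) hcs hk0 hk1 hρ hkn)
      (fun n => zero_le) (fun n => ?_)
    refine le_trans (eLpNorm_congr_ae ?_).le
      (eLpNorm_restrict_le _ _ _ (Ω ∩ Metric.ball x r))
    filter_upwards [ae_restrict_mem (hΩm.inter measurableSet_ball)] with y hy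
    rw [indicator_of_mem hy.1, gradient_mollify hΩm u (hsm n) (hcs n)]
    intro t ht
    refine hin y hy (τ n) ⟨hτpos n, hτlt n⟩ ?_
    have h := hks n t ht
    rw [mem_closedBall_iff_norm] at h ⊢
    have h2 : y - t - (y + τ n • e) = -(t - -(τ n • e)) := by abel
    rwa [h2, norm_neg]

/-- Finite smooth partitions of unity on a compact set, subordinate to a covering by balls. -/
theorem exists_partition {S : Set (E d)} (hS : IsCompact S) {r : E d → ℝ} (hr : ∀ x ∈ S, 0 < r x) :
    ∃ (T : Finset (E d)) (χ : E d → E d → ℝ), (∀ x ∈ T, x ∈ S) ∧ (∀ x, ContDiff ℝ ∞ (χ x)) ∧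
      (∀ x ∈ T, tsupport (χ x) ⊆ Metric.ball x (r x)) ∧ ∀ y ∈ S, ∑ x ∈ T, χ x y = 1 := by
  obtain ⟨T, hTS, hcov⟩ := hS.elim_nhds_subcover (fun x => Metric.ball x (r x))
    (fun x hx => Metric.ball_mem_nhds x (hr x hx))
  obtain ⟨f, hf⟩ := SmoothPartitionOfUnity.exists_isSubordinate (modelWithCornersSelf ℝ (E d))
    hS.isClosed (fun x : T => Metric.ball (x : E d) (r x)) (fun _ => Metric.isOpen_ball)
    (by simpa [iUnion_subtype] using hcov)
  classical
  refine ⟨T, fun x => if h : x ∈ T then f ⟨x, h⟩ else 0, hTS, fun x => ?_, fun x hx => ?_,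
    fun y hy => ?_⟩
  · by_cases h : x ∈ T
    · simpa [h] using (f ⟨x, h⟩).contMDiff.contDiff
    · simp only [h, dif_neg, not_false_eq_true]
      exact contDiff_const (c := (0 : ℝ))
  · simpa [hx] using hf ⟨x, hx⟩
  · have h := f.sum_eq_one hy
    rw [finsum_eq_sum_of_fintype] at h
    rw [← h, ← Finset.sum_coe_sort T]
    simp

theorem norm_gradient (φ : E d → ℝ) (x : E d) : ‖gradient φ x‖ = ‖fderiv ℝ φ x‖ := by
  rw [gradient, LinearIsometryEquiv.norm_map]

theorem continuous_gradient {φ : E d → ℝ} (hφ : ContDiff ℝ ∞ φ) : Continuous (gradient φ) :=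
  (InnerProductSpace.toDual ℝ (E d)).symm.continuous.comp (hφ.continuous_fderiv (by simp))

theorem gradient_sum_mul {T : Finset (E d)} {χ w : E d → E d → ℝ}
    (hχ : ∀ x, ContDiff ℝ ∞ (χ x)) (hw : ∀ x, ContDiff ℝ ∞ (w x)) (y : E d) :
    gradient (fun y => ∑ x ∈ T, χ x y * w x y) y =
      ∑ x ∈ T, (χ x y • gradient (w x) y + w x y • gradient (χ x) y) := by
  have h1 : fderiv ℝ (fun y => ∑ x ∈ T, χ x y * w x y) y =
      ∑ x ∈ T, (χ x y • fderiv ℝ (w x) y + w x y • fderiv ℝ (χ x) y) := by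
    have hd : ∀ x ∈ T, DifferentiableAt ℝ (fun y => χ x y * w x y) y := fun x _ =>
      (((hχ x).mul (hw x)).differentiable (by simp)) y
    rw [fderiv_fun_sum hd]
    refine Finset.sum_congr rfl fun x _ => ?_
    exact fderiv_fun_mul ((hχ x).differentiable (by simp) y) ((hw x).differentiable (by simp) y)
  simp only [gradient, h1, map_sum, map_add, map_smulₛₗ]
  rfl

theorem tendsto_eLpNorm_smul {α F : Type*} [MeasurableSpace α] {μ : Measure α}
    [NormedAddCommGroup F] {f : ℕ → α → F} {G : Type*} [NormedAddCommGroup G] {g : ℕ → α → G}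
    {M : ℝ} (hM : ∀ n, ∀ᵐ x ∂μ, ‖f n x‖ ≤ M * ‖g n x‖)
    (hg : Tendsto (fun n => eLpNorm (g n) 2 μ) atTop (𝓝 0)) :
    Tendsto (fun n => eLpNorm (f n) 2 μ) atTop (𝓝 0) := by
  have h := ENNReal.Tendsto.const_mul (a := ENNReal.ofReal M) hg (Or.inr ENNReal.ofReal_ne_top)
  rw [mul_zero] at h
  exact tendsto_of_tendsto_of_tendsto_of_le_of_le tendsto_const_nhds h (fun n => zero_le)
    (fun n => eLpNorm_le_mul_eLpNorm_of_ae_le_mul (hM n) 2)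

theorem tendsto_eLpNorm_sum {α ι F : Type*} [MeasurableSpace α] {μ : Measure α}
    [NormedAddCommGroup F] {T : Finset ι} {f : ι → ℕ → α → F}
    (hm : ∀ i ∈ T, ∀ n, AEStronglyMeasurable (f i n) μ)
    (hf : ∀ i ∈ T, Tendsto (fun n => eLpNorm (f i n) 2 μ) atTop (𝓝 0)) :
    Tendsto (fun n => eLpNorm (∑ i ∈ T, f i n) 2 μ) atTop (𝓝 0) := by
  have h := tendsto_finsetSum T hf
  rw [Finset.sum_const_zero] at h
  exact tendsto_of_tendsto_of_tendsto_of_le_of_le tendsto_const_nhds h (fun n => zero_le)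
    (fun n => eLpNorm_sum_le (fun i hi => hm i hi n) (by norm_num))

/-- Functions that are smooth on the whole space are dense in `H¹(Ω)` for bounded Lipschitz `Ω`:
the local approximations are patched by a partition of unity. -/
theorem exists_smooth_approx {Ω : Set (E d)} (hΩ : IsOpen Ω) (hb : Bornology.IsBounded Ω)
    (hl : HasLipschitzBoundary Ω) (u : H1 Ω) : ∃ φ : ℕ → E d → ℝ, (∀ n, ContDiff ℝ ∞ (φ n)) ∧
      Tendsto (fun n => eLpNorm (fun x => φ n x - toL2 u x) 2 (volume.restrict Ω)) atTop (𝓝 0) ∧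
      Tendsto (fun n => eLpNorm (fun x => gradient (φ n) x - grad u x) 2 (volume.restrict Ω))
        atTop (𝓝 0) := by
  have hΩm := hΩ.measurableSet
  have hloc : ∀ x : E d, ∃ r : ℝ, ∃ w : ℕ → E d → ℝ, (∀ n, ContDiff ℝ ∞ (w n)) ∧
      (x ∈ closure Ω → 0 < r ∧
        Tendsto (fun n => eLpNorm (fun y => w n y - toL2 u y) 2 (volume.restrict Ω)) atTop (𝓝 0) ∧
        Tendsto (fun n => eLpNorm (fun y => gradient (w n) y - grad u y) 2
          (volume.restrict (Ω ∩ Metric.ball x r))) atTop (𝓝 0)) := by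
    intro x
    by_cases hx : x ∈ closure Ω
    · obtain ⟨r, hr, w, hw, h⟩ := exists_local_approx hΩ hl hx u
      exact ⟨r, w, hw, fun _ => ⟨hr, h⟩⟩
    · exact ⟨0, fun _ _ => 0, fun _ => contDiff_const, fun h => (hx h).elim⟩
  choose r w hw hloc using hloc
  obtain ⟨T, χ, hTS, hχ, hχs, hχ1⟩ := exists_partition hb.isCompact_closure
    (fun x hx => (hloc x hx).1)
  have hχc : ∀ x ∈ T, HasCompactSupport (χ x) := fun x hx =>
    HasCompactSupport.of_support_subset_isCompact (isCompact_closedBall x (r x))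
      ((subset_tsupport _).trans ((hχs x hx).trans Metric.ball_subset_closedBall))
  have hsum : ∀ y ∈ Ω, ∑ x ∈ T, χ x y = 1 := fun y hy => hχ1 y (subset_closure hy)
  have hsum' : ∀ y ∈ Ω, ∑ x ∈ T, gradient (χ x) y = 0 := by
    intro y hy
    have h1 : (fun y => ∑ x ∈ T, χ x y) =ᶠ[𝓝 y] fun _ => 1 := by
      filter_upwards [hΩ.mem_nhds hy] with z hz using hsum z hz
    have h2 := h1.fderiv_eq (𝕜 := ℝ)
    rw [fderiv_fun_sum (fun x _ => (hχ x).differentiable (by simp) y), fderiv_fun_const] at h2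
    simp only [gradient, ← map_sum, h2]
    simp
  have hmu : AEStronglyMeasurable (toL2 u) (volume.restrict Ω) := Lp.aestronglyMeasurable _
  have hmG : AEStronglyMeasurable (grad u) (volume.restrict Ω) := Lp.aestronglyMeasurable _
  have mw : ∀ x n, AEStronglyMeasurable (fun y => w x n y - toL2 u y) (volume.restrict Ω) :=
    fun x n => (hw x n).continuous.aestronglyMeasurable.sub hmu
  have mG : ∀ x n, AEStronglyMeasurable (fun y => gradient (w x n) y - grad u y)
      (volume.restrict Ω) :=
    fun x n => (continuous_gradient (hw x n)).aestronglyMeasurable.sub hmG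
  refine ⟨fun n y => ∑ x ∈ T, χ x y * w x n y, fun n =>
    ContDiff.sum fun x _ => (hχ x).mul (hw x n), ?_, ?_⟩
  · have h : Tendsto (fun n => eLpNorm (∑ x ∈ T, fun y => χ x y * (w x n y - toL2 u y)) 2
        (volume.restrict Ω)) atTop (𝓝 0) := by
      refine tendsto_eLpNorm_sum (f := fun x n y => χ x y * (w x n y - toL2 u y))
        (fun x _ n => (hχ x).continuous.aestronglyMeasurable.mul (mw x n)) fun x hx => ?_
      obtain ⟨M, hM⟩ := (hχ x).continuous.bounded_above_of_compact_support (hχc x hx)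
      refine tendsto_eLpNorm_smul (M := M) (fun n => ae_of_all _ fun y => ?_)
        (hloc x (hTS x hx)).2.1
      rw [norm_mul]
      gcongr
      exact hM y
    refine h.congr fun n => eLpNorm_congr_ae ?_
    filter_upwards [ae_restrict_mem hΩm] with y hy
    simp only [Finset.sum_apply, mul_sub, Finset.sum_sub_distrib, ← Finset.sum_mul, hsum y hy,
      one_mul]
  · have h : Tendsto (fun n => eLpNorm (∑ x ∈ T, ((fun y => χ x y • (gradient (w x n) y - grad u y))
        + fun y => (w x n y - toL2 u y) • gradient (χ x) y)) 2
        (volume.restrict Ω)) atTop (𝓝 0) := by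
      have m1 : ∀ x n, AEStronglyMeasurable (fun y => χ x y • (gradient (w x n) y - grad u y))
          (volume.restrict Ω) := fun x n =>
        (hχ x).continuous.aestronglyMeasurable.smul (mG x n)
      have m2 : ∀ x n, AEStronglyMeasurable (fun y => (w x n y - toL2 u y) • gradient (χ x) y)
          (volume.restrict Ω) := fun x n =>
        (mw x n).smul (continuous_gradient (hχ x)).aestronglyMeasurable
      refine tendsto_eLpNorm_sum (f := fun x n => (fun y => χ x y • (gradient (w x n) y - grad u y))
        + fun y => (w x n y - toL2 u y) • gradient (χ x) y)
        (fun x _ n => (m1 x n).add (m2 x n)) fun x hx => ?_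
      obtain ⟨M, hM⟩ := (hχ x).continuous.bounded_above_of_compact_support (hχc x hx)
      obtain ⟨M', hM'⟩ := ((hχ x).continuous_fderiv (by simp)).bounded_above_of_compact_support
        ((hχc x hx).fderiv ℝ)
      have t1 : Tendsto (fun n => eLpNorm (fun y => χ x y • (gradient (w x n) y - grad u y)) 2
          (volume.restrict Ω)) atTop (𝓝 0) := by
        have h := tendsto_eLpNorm_smul (M := M) (μ := volume.restrict (Ω ∩ Metric.ball x (r x)))
          (f := fun n y => χ x y • (gradient (w x n) y - grad u y))
          (fun n => ae_of_all _ fun y => by rw [norm_smul]; gcongr; exact hM y)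
          (hloc x (hTS x hx)).2.2
        refine h.congr fun n => ?_
        rw [← eLpNorm_indicator_eq_eLpNorm_restrict (hΩm.inter measurableSet_ball),
          ← eLpNorm_indicator_eq_eLpNorm_restrict hΩm]
        congr 1
        ext1 y
        by_cases hy : y ∈ Metric.ball x (r x)
        · by_cases hyΩ : y ∈ Ω <;> simp [hy, hyΩ, -Metric.mem_ball]
        · have : χ x y = 0 := image_eq_zero_of_notMem_tsupport fun h => hy (hχs x hx h)
          simp [this, indicator]
      have t2 : Tendsto (fun n => eLpNorm (fun y => (w x n y - toL2 u y) • gradient (χ x) y) 2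
          (volume.restrict Ω)) atTop (𝓝 0) := by
        refine tendsto_eLpNorm_smul (M := M') (fun n => ae_of_all _ fun y => ?_)
          (hloc x (hTS x hx)).2.1
        rw [norm_smul, mul_comm, norm_gradient]
        gcongr
        exact hM' y
      have h := t1.add t2
      rw [add_zero] at h
      exact tendsto_of_tendsto_of_tendsto_of_le_of_le tendsto_const_nhds h (fun n => zero_le)
        (fun n => eLpNorm_add_le (m1 x n) (m2 x n) (by norm_num))
    refine h.congr fun n => eLpNorm_congr_ae ?_
    filter_upwards [ae_restrict_mem hΩm] with y hy
    rw [gradient_sum_mul hχ (fun x => hw x n)]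
    simp only [Finset.sum_apply, Pi.add_apply, smul_sub, sub_smul, Finset.sum_add_distrib,
      Finset.sum_sub_distrib, ← Finset.sum_smul, ← Finset.smul_sum, hsum y hy, hsum' y hy,
      one_smul, smul_zero]
    abel

/-! ### The Hilbert space `H¹(Ω)` -/

theorem norm_sq_H1 {Ω : Set (E d)} (u : H1 Ω) : ‖u‖ ^ 2 = ‖toL2 u‖ ^ 2 + ‖grad u‖ ^ 2 :=
  WithLp.prod_norm_sq_eq_of_L2 (u : L2Pair Ω)

/-- The weak gradient as a bounded operator on `H¹(Ω)`. -/
def gradL (Ω : Set (E d)) : H1 Ω →L[ℝ] Lp (E d) 2 (volume.restrict Ω) :=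
  (WithLp.sndL 2 ℝ _ _).comp (H1 Ω).subtypeL

/-- The inclusion of `H¹(Ω)` into `L²(Ω)` as a bounded operator. -/
def toL2L (Ω : Set (E d)) : H1 Ω →L[ℝ] Lp ℝ 2 (volume.restrict Ω) :=
  (WithLp.fstL 2 ℝ _ _).comp (H1 Ω).subtypeL

theorem gradL_apply {Ω : Set (E d)} (u : H1 Ω) : gradL Ω u = grad u := rfl

/-- `H¹(Ω)` is closed in `L²(Ω) × L²(Ω; ℝ^d)`: for a fixed test function, the equation defining the
weak gradient is continuous in the pair. -/
theorem isClosed_H1 (Ω : Set (E d)) : IsClosed (H1 Ω : Set (L2Pair Ω)) := by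
  have h : (H1 Ω : Set (L2Pair Ω)) = ⋂ (φ : E d → ℝ) (_ : ContDiff ℝ ∞ φ)
      (_ : HasCompactSupport φ) (_ : tsupport φ ⊆ Ω) (y : E d),
      {p | ∫ x in Ω, p.fst x * fderiv ℝ φ x y = - ∫ x in Ω, φ x * ⟪p.snd x, y⟫} := by
    ext p
    simp only [mem_iInter]
    rfl
  rw [h]
  refine isClosed_iInter fun φ => isClosed_iInter fun hφ => isClosed_iInter fun hc =>
    isClosed_iInter fun _ => isClosed_iInter fun y => ?_
  have c1 : Continuous (fun x => fderiv ℝ φ x y) :=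
    (hφ.continuous_fderiv (by simp)).clm_apply continuous_const
  have m1 : MemLp (fun x => fderiv ℝ φ x y) 2 (volume.restrict Ω) :=
    c1.memLp_of_hasCompactSupport (hc.fderiv_apply (𝕜 := ℝ) y)
  have m2 : MemLp (fun x => φ x • y) 2 (volume.restrict Ω) :=
    (hφ.continuous.smul continuous_const).memLp_of_hasCompactSupport hc.smul_right
  have e1 : ∀ p : L2Pair Ω, ∫ x in Ω, p.fst x * fderiv ℝ φ x y = ⟪m1.toLp _, p.fst⟫ := by
    intro p
    rw [L2.inner_def]
    refine integral_congr_ae ?_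
    filter_upwards [m1.coeFn_toLp] with x hx
    rw [hx]
    rfl
  have e2 : ∀ p : L2Pair Ω, ∫ x in Ω, φ x * ⟪p.snd x, y⟫ = ⟪m2.toLp _, p.snd⟫ := by
    intro p
    rw [L2.inner_def]
    refine integral_congr_ae ?_
    filter_upwards [m2.coeFn_toLp] with x hx
    rw [hx, real_inner_smul_left, real_inner_comm]
  simp only [e1, e2]
  have k1 : Continuous fun p : L2Pair Ω => p.fst := (WithLp.fstL 2 ℝ _ _).continuous
  have k2 : Continuous fun p : L2Pair Ω => p.snd := (WithLp.sndL 2 ℝ _ _).continuous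
  exact isClosed_eq (continuous_const.inner k1) (continuous_const.inner k2).neg

instance (Ω : Set (E d)) : CompleteSpace (H1 Ω) := (isClosed_H1 Ω).completeSpace_coe

/-- The smooth functions on the whole space. -/
def smoothFunctions (d : ℕ) : Submodule ℝ (E d → ℝ) where
  carrier := {φ | ContDiff ℝ ∞ φ}
  zero_mem' := mem_ofPred_eq ▸ contDiff_const (c := (0 : ℝ))
  add_mem' := by
    intro φ ψ hφ hψ
    rw [mem_ofPred_eq] at *
    exact hφ.add hψ
  smul_mem' := by
    intro c φ hφ
    rw [mem_ofPred_eq] at *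
    exact contDiff_const.smul hφ

theorem contDiff_coe (φ : smoothFunctions d) : ContDiff ℝ ∞ (φ : E d → ℝ) :=
  mem_ofPred_eq.mp φ.2

theorem continuous_coe (φ : smoothFunctions d) : Continuous (φ : E d → ℝ) :=
  (contDiff_coe φ).continuous

theorem memLp_of_continuous {F : Type*} [NormedAddCommGroup F] {Ω : Set (E d)} (hΩ : IsOpen Ω)
    (hb : Bornology.IsBounded Ω) {f : E d → F} (hf : Continuous f) :
    MemLp f 2 (volume.restrict Ω) := by
  have : IsFiniteMeasure (volume.restrict Ω) := ⟨by simpa using hb.measure_lt_top⟩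
  obtain ⟨C, hC⟩ := hb.isCompact_closure.exists_bound_of_continuousOn hf.continuousOn
  exact MemLp.of_bound hf.aestronglyMeasurable C
    ((ae_restrict_mem hΩ.measurableSet).mono fun x hx => hC x (subset_closure hx))

theorem hasWeakGradient_smooth {Ω : Set (E d)} {φ : E d → ℝ} (hφ : ContDiff ℝ ∞ φ) :
    HasWeakGradient Ω φ (gradient φ) := by
  intro η hη hc hs y
  have h0 : ∀ x, x ∉ Ω → η x = 0 := fun x hx =>
    image_eq_zero_of_notMem_tsupport fun h => hx (hs h)
  have h0' : ∀ x, x ∉ Ω → fderiv ℝ η x y = 0 := fun x hx => by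
    rw [image_eq_zero_of_notMem_tsupport fun h => hx (hs (tsupport_fderiv_subset ℝ h))]
    rfl
  have hg : ∀ x, ⟪gradient φ x, y⟫ = fderiv ℝ φ x y := fun x => by
    rw [gradient, InnerProductSpace.toDual_symm_apply]
  rw [setIntegral_eq_integral_of_forall_compl_eq_zero (fun x hx => by rw [h0' x hx, mul_zero]),
    setIntegral_eq_integral_of_forall_compl_eq_zero (fun x hx => by rw [h0 x hx, zero_mul])]
  have c1 : Continuous (fun x => fderiv ℝ η x y) :=
    (hη.continuous_fderiv (by simp)).clm_apply continuous_const
  have c2 : Continuous (fun x => fderiv ℝ φ x y) :=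
    (hφ.continuous_fderiv (by simp)).clm_apply continuous_const
  rw [integral_mul_fderiv_eq_neg_fderiv_mul_of_integrable
    ((c2.mul hη.continuous).integrable_of_hasCompactSupport hc.mul_left)
    ((hφ.continuous.mul c1).integrable_of_hasCompactSupport (hc.fderiv_apply (𝕜 := ℝ) y).mul_left)
    ((hφ.continuous.mul hη.continuous).integrable_of_hasCompactSupport hc.mul_left)
    (fun x _ => hφ.differentiable (by simp) x) (fun x _ => hη.differentiable (by simp) x)]
  simp only [hg, mul_comm]

theorem HasWeakGradient.congr {Ω : Set (E d)} {u u' : E d → ℝ} {G G' : E d → E d}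
    (h : HasWeakGradient Ω u G) (hu : u' =ᵐ[volume.restrict Ω] u)
    (hG : G' =ᵐ[volume.restrict Ω] G) : HasWeakGradient Ω u' G' := by
  intro η hη hc hs y
  have e1 : ∫ x in Ω, u' x * fderiv ℝ η x y = ∫ x in Ω, u x * fderiv ℝ η x y :=
    integral_congr_ae (hu.mono fun x hx => by simp only [hx])
  have e2 : ∫ x in Ω, η x * ⟪G' x, y⟫ = ∫ x in Ω, η x * ⟪G x, y⟫ :=
    integral_congr_ae (hG.mono fun x hx => by simp only [hx])
  rw [e1, e2, h η hη hc hs y]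

theorem gradient_add {φ ψ : E d → ℝ} (hφ : ContDiff ℝ ∞ φ) (hψ : ContDiff ℝ ∞ ψ) :
    gradient (φ + ψ) = gradient φ + gradient ψ := by
  ext1 x
  simp only [gradient, Pi.add_apply]
  rw [fderiv_add (hφ.differentiable (by simp) x) (hψ.differentiable (by simp) x), map_add]

theorem gradient_smul (c : ℝ) {φ : E d → ℝ} (hφ : ContDiff ℝ ∞ φ) :
    gradient (c • φ) = c • gradient φ := by
  ext1 x
  simp only [gradient, Pi.smul_apply]
  rw [fderiv_const_smul (hφ.differentiable (by simp) x), map_smulₛₗ]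
  rfl

/-- A smooth function as an element of `H¹(Ω)`, `Ω` bounded. -/
def smoothH1 {Ω : Set (E d)} (hΩ : IsOpen Ω) (hb : Bornology.IsBounded Ω) :
    smoothFunctions d →ₗ[ℝ] H1 Ω where
  toFun φ := ⟨WithLp.toLp 2 ((memLp_of_continuous hΩ hb (continuous_coe φ)).toLp φ.1,
      (memLp_of_continuous hΩ hb (continuous_gradient (contDiff_coe φ))).toLp (gradient φ.1)),
    (hasWeakGradient_smooth (contDiff_coe φ)).congr
      (MemLp.coeFn_toLp (memLp_of_continuous hΩ hb (continuous_coe φ)))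
      (MemLp.coeFn_toLp (memLp_of_continuous hΩ hb (continuous_gradient (contDiff_coe φ))))⟩
  map_add' φ ψ := by
    refine Subtype.ext (congrArg (WithLp.toLp 2) (Prod.ext ?_ ?_))
    · exact MemLp.toLp_add (memLp_of_continuous hΩ hb (continuous_coe φ))
        (memLp_of_continuous hΩ hb (continuous_coe ψ))
    · exact (MemLp.toLp_congr
        (memLp_of_continuous hΩ hb (continuous_gradient (contDiff_coe (φ + ψ)))) _
        (ae_of_all _ fun x => congrFun (gradient_add (contDiff_coe φ) (contDiff_coe ψ)) x)).trans
        (MemLp.toLp_add (memLp_of_continuous hΩ hb (continuous_gradient (contDiff_coe φ)))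
          (memLp_of_continuous hΩ hb (continuous_gradient (contDiff_coe ψ))))
  map_smul' c φ := by
    refine Subtype.ext (congrArg (WithLp.toLp 2) (Prod.ext ?_ ?_))
    · exact MemLp.toLp_const_smul c (memLp_of_continuous hΩ hb (continuous_coe φ))
    · exact (MemLp.toLp_congr
        (memLp_of_continuous hΩ hb (continuous_gradient (contDiff_coe (c • φ)))) _
        (ae_of_all _ fun x => congrFun (gradient_smul c (contDiff_coe φ)) x)).trans
        (MemLp.toLp_const_smul c (memLp_of_continuous hΩ hb (continuous_gradient (contDiff_coe φ))))

theorem toL2_smoothH1 {Ω : Set (E d)} (hΩ : IsOpen Ω) (hb : Bornology.IsBounded Ω)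
    (φ : smoothFunctions d) : toL2 (smoothH1 hΩ hb φ) =
      (memLp_of_continuous hΩ hb (continuous_coe φ)).toLp φ.1 := rfl

theorem grad_smoothH1 {Ω : Set (E d)} (hΩ : IsOpen Ω) (hb : Bornology.IsBounded Ω)
    (φ : smoothFunctions d) : grad (smoothH1 hΩ hb φ) =
      (memLp_of_continuous hΩ hb (continuous_gradient (contDiff_coe φ))).toLp (gradient φ.1) := rfl

theorem tendsto_toLp_iff {α F : Type*} [MeasurableSpace α] {μ : Measure α} [NormedAddCommGroup F]
    {f : ℕ → α → F} (hf : ∀ n, MemLp (f n) 2 μ) (g : Lp F 2 μ) :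
    Tendsto (fun n => (hf n).toLp (f n)) atTop (𝓝 g) ↔
      Tendsto (fun n => eLpNorm (fun x => f n x - g x) 2 μ) atTop (𝓝 0) := by
  rw [Lp.tendsto_Lp_iff_tendsto_eLpNorm']
  refine tendsto_congr fun n => eLpNorm_congr_ae ?_
  filter_upwards [(hf n).coeFn_toLp] with x hx
  simp only [Pi.sub_apply, hx]

theorem tendsto_H1_iff {Ω : Set (E d)} {w : ℕ → H1 Ω} {u : H1 Ω} :
    Tendsto w atTop (𝓝 u) ↔ Tendsto (fun n => toL2 (w n)) atTop (𝓝 (toL2 u)) ∧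
      Tendsto (fun n => grad (w n)) atTop (𝓝 (grad u)) := by
  constructor
  · exact fun h => ⟨((toL2L Ω).continuous.tendsto u).comp h,
      ((gradL Ω).continuous.tendsto u).comp h⟩
  · rintro ⟨h1, h2⟩
    rw [tendsto_iff_norm_sub_tendsto_zero] at h1 h2 ⊢
    have h3 := (h1.pow 2).add (h2.pow 2)
    have h4 : ∀ n, ‖w n - u‖ ^ 2 = ‖toL2 (w n) - toL2 u‖ ^ 2 + ‖grad (w n) - grad u‖ ^ 2 :=
      fun n => norm_sq_H1 (w n - u)
    simp only [← h4] at h3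
    have h5 := h3.sqrt
    simpa using h5

theorem tendsto_smoothH1_iff {Ω : Set (E d)} (hΩ : IsOpen Ω) (hb : Bornology.IsBounded Ω)
    {φ : ℕ → smoothFunctions d} {u : H1 Ω} :
    Tendsto (fun n => smoothH1 hΩ hb (φ n)) atTop (𝓝 u) ↔
      Tendsto (fun n => eLpNorm (fun x => (φ n).1 x - toL2 u x) 2 (volume.restrict Ω)) atTop (𝓝 0) ∧
      Tendsto (fun n => eLpNorm (fun x => gradient (φ n).1 x - grad u x) 2 (volume.restrict Ω))
        atTop (𝓝 0) := by
  rw [tendsto_H1_iff]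
  simp only [toL2_smoothH1, grad_smoothH1]
  rw [tendsto_toLp_iff, tendsto_toLp_iff]

theorem denseRange_smoothH1 {Ω : Set (E d)} (hΩ : IsOpen Ω) (hb : Bornology.IsBounded Ω)
    (hl : HasLipschitzBoundary Ω) : DenseRange (smoothH1 hΩ hb) := by
  intro u
  obtain ⟨φ, hφ, h1, h2⟩ := exists_smooth_approx hΩ hb hl u
  exact mem_closure_of_tendsto
    ((tendsto_smoothH1_iff hΩ hb (φ := fun n => ⟨φ n, hφ n⟩)).2 ⟨h1, h2⟩)
    (Eventually.of_forall fun n => mem_range_self _)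

/-! ### The trace operator -/

/-- `S` is a compact surface for which the trace inequality holds on smooth functions. -/
structure AdmitsTrace (Ω S : Set (E d)) : Prop where
  isCompact : IsCompact S
  bound : ∃ C : ℝ≥0∞, C ≠ ⊤ ∧ ∀ φ : E d → ℝ, ContDiff ℝ ∞ φ →
    ∫⁻ x in S, ‖φ x‖ₑ ^ 2 ∂Measure.euclideanHausdorffMeasure (d - 1) ≤
      C * ((∫⁻ x in Ω, ‖φ x‖ₑ ^ 2) + ∫⁻ x in Ω, ‖fderiv ℝ φ x‖ₑ ^ 2)

theorem map_surfaceMeasure (S : Set (E d)) :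
    (surfaceMeasure S).map Subtype.val =
      (Measure.euclideanHausdorffMeasure (d - 1) : Measure (E d)).restrict S := by
  rw [surfaceMeasure, isometry_subtype_coe.map_euclideanHausdorffMeasure, Subtype.range_coe]

theorem lintegral_surfaceMeasure (S : Set (E d)) {f : E d → ℝ≥0∞} (hf : Measurable f) :
    ∫⁻ s : S, f s ∂surfaceMeasure S =
      ∫⁻ x in S, f x ∂Measure.euclideanHausdorffMeasure (d - 1) := by
  rw [← map_surfaceMeasure, lintegral_map hf measurable_subtype_coe]

/-- The trace inequality for the constant `1` bounds the surface area. -/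
theorem AdmitsTrace.hausdorff_lt_top {Ω S : Set (E d)} (h : AdmitsTrace Ω S)
    (hb : Bornology.IsBounded Ω) :
    (Measure.euclideanHausdorffMeasure (d - 1) : Measure (E d)) S < ⊤ := by
  obtain ⟨C, hC, hbd⟩ := h.bound
  have h1 : (Measure.euclideanHausdorffMeasure (d - 1) : Measure (E d)) S ≤ C * volume Ω := by
    have h3 : ∀ x : E d, ‖fderiv ℝ (fun _ : E d => (1 : ℝ)) x‖ₑ = 0 := by
      intro x
      rw [fderiv_const_apply, ← ofReal_norm, norm_zero, ENNReal.ofReal_zero]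
    have h4 := hbd (fun _ => 1) contDiff_const
    simp only [h3] at h4
    simpa using h4
  have h2 : (volume : Measure (E d)) Ω < ⊤ := hb.measure_lt_top
  exact h1.trans_lt (ENNReal.mul_lt_top hC.lt_top h2)

theorem AdmitsTrace.isFiniteMeasure {Ω S : Set (E d)} (h : AdmitsTrace Ω S)
    (hb : Bornology.IsBounded Ω) : IsFiniteMeasure (surfaceMeasure S) := by
  refine ⟨?_⟩
  have h1 := congrArg (fun μ => μ univ) (map_surfaceMeasure S)
  simp only [Measure.restrict_apply_univ] at h1
  rw [Measure.map_apply measurable_subtype_coe MeasurableSet.univ, preimage_univ] at h1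
  rw [h1]
  exact h.hausdorff_lt_top hb

/-- A compact surface of finite area is a null set. -/
theorem AdmitsTrace.volume_eq_zero {Ω S : Set (E d)} (h : AdmitsTrace Ω S)
    (hb : Bornology.IsBounded Ω) (hd : 0 < d) : (volume : Measure (E d)) S = 0 := by
  rw [← EuclideanSpace.euclideanHausdorffMeasure_eq_volume]
  exact (Measure.euclideanHausdorffMeasure_zero_or_top (by omega : d - 1 < d) S).resolve_right
    (h.hausdorff_lt_top hb).ne

theorem memLp_restrict_surface {S : Set (E d)} (hS : IsCompact S)
    (hfin : IsFiniteMeasure (surfaceMeasure S)) {f : E d → ℝ} (hf : Continuous f) :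
    MemLp (fun s : S => f s) 2 (surfaceMeasure S) := by
  obtain ⟨C, hC⟩ := hS.exists_bound_of_continuousOn hf.continuousOn
  exact MemLp.of_bound (hf.comp continuous_subtype_val).aestronglyMeasurable C
    (ae_of_all _ fun s => hC s s.2)

/-- Restriction of smooth functions to a surface. -/
def restrictSurface {S : Set (E d)} (hS : IsCompact S) (hfin : IsFiniteMeasure (surfaceMeasure S)) :
    smoothFunctions d →ₗ[ℝ] L2Surface S where
  toFun φ := (memLp_restrict_surface hS hfin (continuous_coe φ)).toLp _
  map_add' _ _ := MemLp.toLp_add _ _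
  map_smul' _ _ := MemLp.toLp_const_smul _ _

theorem isTrace_iff {Ω S : Set (E d)} (hΩ : IsOpen Ω) (hb : Bornology.IsBounded Ω)
    (hS : IsCompact S) (hfin : IsFiniteMeasure (surfaceMeasure S)) {u : H1 Ω} {f : L2Surface S} :
    IsTrace S u f ↔ ∃ φ : ℕ → smoothFunctions d,
      Tendsto (fun n => smoothH1 hΩ hb (φ n)) atTop (𝓝 u) ∧
      Tendsto (fun n => restrictSurface hS hfin (φ n)) atTop (𝓝 f) := by
  have key : ∀ φ : ℕ → smoothFunctions d,
      Tendsto (fun n => restrictSurface hS hfin (φ n)) atTop (𝓝 f) ↔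
      Tendsto (fun n => eLpNorm (fun s : S => (φ n).1 s - f s) 2 (surfaceMeasure S))
        atTop (𝓝 0) := fun φ => tendsto_toLp_iff
          (fun n => memLp_restrict_surface hS hfin (continuous_coe (φ n))) f
  constructor
  · rintro ⟨φ, hφ, h1, h2, h3⟩
    exact ⟨fun n => ⟨φ n, hφ n⟩, (tendsto_smoothH1_iff hΩ hb).2 ⟨h1, h2⟩, (key _).2 h3⟩
  · rintro ⟨φ, h, h3⟩
    obtain ⟨h1, h2⟩ := (tendsto_smoothH1_iff hΩ hb).1 h
    exact ⟨fun n => (φ n).1, fun n => contDiff_coe (φ n), h1, h2, (key _).1 h3⟩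

theorem ofReal_norm_sq_eq_lintegral {α F : Type*} [MeasurableSpace α] {μ : Measure α}
    [NormedAddCommGroup F] [NormedSpace ℝ F] {f : α → F} (hf : MemLp f 2 μ) :
    ENNReal.ofReal (‖hf.toLp f‖ ^ 2) = ∫⁻ x, ‖f x‖ₑ ^ 2 ∂μ := by
  rw [ENNReal.ofReal_pow (norm_nonneg _), ofReal_norm, Lp.enorm_toLp, eLpNorm_two_sq]

theorem lintegral_gradient_sq (μ : Measure (E d)) (φ : E d → ℝ) :
    ∫⁻ x, ‖gradient φ x‖ₑ ^ 2 ∂μ = ∫⁻ x, ‖fderiv ℝ φ x‖ₑ ^ 2 ∂μ := by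
  refine lintegral_congr fun x => ?_
  rw [← ofReal_norm, norm_gradient, ofReal_norm]

theorem ofReal_norm_restrictSurface {S : Set (E d)} (hS : IsCompact S)
    (hfin : IsFiniteMeasure (surfaceMeasure S)) (φ : smoothFunctions d) :
    ENNReal.ofReal (‖restrictSurface hS hfin φ‖ ^ 2) =
      ∫⁻ x in S, ‖φ.1 x‖ₑ ^ 2 ∂Measure.euclideanHausdorffMeasure (d - 1) := by
  rw [← lintegral_surfaceMeasure S (measurable_enorm_sq (contDiff_coe φ))]
  exact ofReal_norm_sq_eq_lintegral (memLp_restrict_surface hS hfin (continuous_coe φ))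

theorem ofReal_norm_toL2_smoothH1 {Ω : Set (E d)} (hΩ : IsOpen Ω) (hb : Bornology.IsBounded Ω)
    (φ : smoothFunctions d) :
    ENNReal.ofReal (‖toL2 (smoothH1 hΩ hb φ)‖ ^ 2) = ∫⁻ x in Ω, ‖φ.1 x‖ₑ ^ 2 := by
  rw [toL2_smoothH1, ofReal_norm_sq_eq_lintegral]

theorem ofReal_norm_grad_smoothH1 {Ω : Set (E d)} (hΩ : IsOpen Ω) (hb : Bornology.IsBounded Ω)
    (φ : smoothFunctions d) :
    ENNReal.ofReal (‖grad (smoothH1 hΩ hb φ)‖ ^ 2) = ∫⁻ x in Ω, ‖fderiv ℝ φ.1 x‖ₑ ^ 2 := by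
  rw [← lintegral_gradient_sq, grad_smoothH1, ofReal_norm_sq_eq_lintegral]

theorem exists_norm_restrictSurface_le {Ω S : Set (E d)} (hΩ : IsOpen Ω)
    (hb : Bornology.IsBounded Ω) (h : AdmitsTrace Ω S)
    (hfin : IsFiniteMeasure (surfaceMeasure S)) :
    ∃ C, ∀ φ, ‖restrictSurface h.isCompact hfin φ‖ ≤ C * ‖smoothH1 hΩ hb φ‖ := by
  obtain ⟨C, hC, hbd⟩ := h.bound
  refine ⟨√C.toReal, fun φ => ?_⟩
  have h1 := hbd φ.1 (contDiff_coe φ)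
  rw [← ofReal_norm_restrictSurface h.isCompact hfin, ← ofReal_norm_toL2_smoothH1 hΩ hb,
    ← ofReal_norm_grad_smoothH1 hΩ hb, ← ENNReal.ofReal_add (by positivity) (by positivity),
    ← norm_sq_H1, ← ENNReal.ofReal_toReal hC, ← ENNReal.ofReal_mul ENNReal.toReal_nonneg,
    ENNReal.ofReal_le_ofReal_iff (by positivity)] at h1
  have h2 := Real.sqrt_le_sqrt h1
  rwa [Real.sqrt_mul ENNReal.toReal_nonneg, Real.sqrt_sq (norm_nonneg _),
    Real.sqrt_sq (norm_nonneg _)] at h2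

/-- The trace operator as a bounded operator, the continuous extension of the restriction of smooth
functions. -/
theorem exists_traceL {Ω S : Set (E d)} (hΩ : IsOpen Ω) (hb : Bornology.IsBounded Ω)
    (hl : HasLipschitzBoundary Ω) (h : AdmitsTrace Ω S) :
    ∃ T : H1 Ω →L[ℝ] L2Surface S, (∀ u, trace S u = T u) ∧
      ∀ (hfin : IsFiniteMeasure (surfaceMeasure S)) (φ : smoothFunctions d),
        T (smoothH1 hΩ hb φ) = restrictSurface h.isCompact hfin φ := by
  have hfin := h.isFiniteMeasure hb
  have hdense := denseRange_smoothH1 hΩ hb hl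
  have hbd := exists_norm_restrictSurface_le hΩ hb h hfin
  set T := (restrictSurface h.isCompact hfin).extendOfNorm (smoothH1 hΩ hb) with hT
  have hTe : ∀ φ, T (smoothH1 hΩ hb φ) = restrictSurface h.isCompact hfin φ :=
    LinearMap.extendOfNorm_eq hdense hbd
  have hiff : ∀ u f, IsTrace S u f ↔ f = T u := by
    intro u f
    rw [isTrace_iff hΩ hb h.isCompact hfin]
    constructor
    · rintro ⟨φ, h1, h2⟩
      have h3 := (T.continuous.tendsto u).comp h1
      simp only [Function.comp_def, hTe] at h3
      exact tendsto_nhds_unique h2 h3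
    · rintro rfl
      obtain ⟨φ, hφ, h1, h2⟩ := exists_smooth_approx hΩ hb hl u
      have h3 := (tendsto_smoothH1_iff hΩ hb (φ := fun n => ⟨φ n, hφ n⟩)).2 ⟨h1, h2⟩
      refine ⟨_, h3, ?_⟩
      have h4 := (T.continuous.tendsto u).comp h3
      simpa only [Function.comp_def, hTe] using h4
  refine ⟨T, fun u => (hiff u _).1 ?_, fun _ => hTe⟩
  exact Classical.epsilon_spec (p := fun f => IsTrace S u f) ⟨T u, (hiff u _).2 rfl⟩

/-- The Poincaré inequality on `H¹(Ω)`, from the one for smooth functions by density. -/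
theorem exists_poincare {Ω S : Set (E d)} (hΩ : IsOpen Ω) (hb : Bornology.IsBounded Ω)
    (hl : HasLipschitzBoundary Ω) (h : AdmitsTrace Ω S) (hc : Controlled Ω S Ω)
    {T : H1 Ω →L[ℝ] L2Surface S}
    (hT : ∀ (hfin : IsFiniteMeasure (surfaceMeasure S)) (φ : smoothFunctions d),
        T (smoothH1 hΩ hb φ) = restrictSurface h.isCompact hfin φ) :
    ∃ C : ℝ, 0 ≤ C ∧ ∀ u : H1 Ω, ‖toL2 u‖ ^ 2 ≤ C * (‖grad u‖ ^ 2 + ‖T u‖ ^ 2) := by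
  obtain ⟨C, hC, hbd⟩ := hc
  have hfin := h.isFiniteMeasure hb
  refine ⟨C.toReal, ENNReal.toReal_nonneg, fun u => ?_⟩
  have k1 : Continuous fun u : H1 Ω => ‖toL2 u‖ ^ 2 := ((toL2L Ω).continuous.norm).pow 2
  have k2 : Continuous fun u : H1 Ω => C.toReal * (‖grad u‖ ^ 2 + ‖T u‖ ^ 2) :=
    continuous_const.mul ((((gradL Ω).continuous.norm).pow 2).add ((T.continuous.norm).pow 2))
  refine (denseRange_smoothH1 hΩ hb hl).induction_on u (isClosed_le k1 k2) fun φ => ?_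
  have h1 := hbd φ.1 (contDiff_coe φ)
  rwa [energy, ← ofReal_norm_restrictSurface h.isCompact hfin, ← hT hfin,
    ← ofReal_norm_toL2_smoothH1 hΩ hb,
    ← ofReal_norm_grad_smoothH1 hΩ hb, ← ENNReal.ofReal_add (by positivity) (by positivity),
    ← ENNReal.ofReal_toReal hC, ← ENNReal.ofReal_mul ENNReal.toReal_nonneg,
    ENNReal.ofReal_le_ofReal_iff (by positivity)] at h1

/-! ### Coercive problems and the adjoint method -/

section Abstract

variable {H X : Type*} [NormedAddCommGroup H] [InnerProductSpace ℝ H]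
  [NormedAddCommGroup X] [InnerProductSpace ℝ X]

/-- The Lax–Milgram lemma. -/
theorem exists_forall_eq_iff_of_isCoercive [CompleteSpace H] {B : H →L[ℝ] H →L[ℝ] ℝ}
    (hB : IsCoercive B) (ℓ : H →L[ℝ] ℝ) : ∃ u : H, ∀ u' : H, (∀ w, B u' w = ℓ w) ↔ u' = u := by
  set A := hB.continuousLinearEquivOfBilin
  refine ⟨A.symm ((InnerProductSpace.toDual ℝ H).symm ℓ), fun u' => ?_⟩
  rw [ContinuousLinearEquiv.eq_symm_apply]
  have h : ∀ w, B u' w = ⟪A u', w⟫ := fun w => (hB.continuousLinearEquivOfBilin_apply u' w).symm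
  constructor
  · intro hu
    refine ext_inner_right ℝ fun w => ?_
    rw [← h, hu, InnerProductSpace.toDual_symm_apply]
  · intro hu w
    rw [h, hu, InnerProductSpace.toDual_symm_apply]

/-- The adjoint method. Let `u t` solve `B(u, w) + t M(u, w) = ℓ(w)` for small `t`, with `B`
symmetric and coercive, and let `v` solve the adjoint problem
`B(v, w) + ⟪T (u 0) - a, T w⟫ = 0`. Then `½ ‖T (u t) - a‖²` has derivative `M(u 0, v)` at `t = 0`.
With `δ = u t - u 0`, testing the adjoint problem with `δ` gives
`⟪T (u 0) - a, T δ⟫ = t M(u t, v)`, and coercivity gives `δ = O(t)`. -/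
theorem hasDerivAt_half_norm_sq {B M : H →L[ℝ] H →L[ℝ] ℝ} (hB : IsCoercive B)
    (hBs : ∀ u w, B u w = B w u) {ℓ : H →L[ℝ] ℝ} {T : H →L[ℝ] X} {a : X} {u : ℝ → H}
    (hu : ∀ᶠ t in 𝓝 (0 : ℝ), ∀ w, B (u t) w + t * M (u t) w = ℓ w) {v : H}
    (hv : ∀ w, B v w + ⟪T (u 0) - a, T w⟫ = 0) :
    HasDerivAt (fun t => 1 / 2 * ‖T (u t) - a‖ ^ 2) (M (u 0) v) 0 := by
  obtain ⟨c, hc, hcoer⟩ := hB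
  have hu0 : ∀ w, B (u 0) w = ℓ w := by
    intro w
    have := hu.self_of_nhds w
    simpa using this
  set N : ℝ := ‖M‖ + 1 with hN
  have hNpos : 0 < N := by positivity
  have hM : ∀ x y, |M x y| ≤ N * ‖x‖ * ‖y‖ := fun x y => by
    refine (M.le_opNorm₂ x y).trans ?_
    gcongr
    linarith
  have hsmall : ∀ᶠ t : ℝ in 𝓝 0, |t| * N < c / 2 := by
    have : Tendsto (fun t : ℝ => |t| * N) (𝓝 0) (𝓝 (|0| * N)) :=
      (continuous_abs.mul continuous_const).tendsto 0
    rw [abs_zero, zero_mul] at this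
    exact this.eventually (gt_mem_nhds (by positivity))
  have hδ : ∀ᶠ t : ℝ in 𝓝 0, ‖u t - u 0‖ ≤ 2 * N * ‖u 0‖ / c * |t| := by
    filter_upwards [hu, hsmall] with t ht hts
    set δ := u t - u 0 with hδdef
    have hsub : ∀ (A : H →L[ℝ] H →L[ℝ] ℝ) w, A δ w = A (u t) w - A (u 0) w := fun A w => by
      rw [hδdef, map_sub]; rfl
    have e1 : B δ δ = -(t * M (u t) δ) := by
      have h1 := ht δ
      have h2 := hu0 δ
      rw [hsub]
      linarith
    have e2 : c * ‖δ‖ * ‖δ‖ ≤ |t| * (N * ‖u t‖ * ‖δ‖) := by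
      refine (hcoer δ).trans ?_
      rw [e1]
      refine (neg_le_abs _).trans ?_
      rw [abs_mul]
      gcongr
      exact hM _ _
    have e3 : ‖u t‖ ≤ ‖u 0‖ + ‖δ‖ := by
      calc ‖u t‖ = ‖u 0 + δ‖ := by rw [hδdef]; congr 1; abel
        _ ≤ _ := norm_add_le _ _
    rcases (norm_nonneg δ).eq_or_lt with h0 | h0
    · rw [← h0]; positivity
    have e4 : c * ‖δ‖ ≤ |t| * N * ‖u t‖ := by
      refine le_of_mul_le_mul_right ?_ h0
      calc _ ≤ _ := e2
        _ = _ := by ring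
    have e5 : |t| * N * ‖u t‖ ≤ |t| * N * ‖u 0‖ + c / 2 * ‖δ‖ := by
      calc |t| * N * ‖u t‖ ≤ |t| * N * (‖u 0‖ + ‖δ‖) := by gcongr
        _ = |t| * N * ‖u 0‖ + |t| * N * ‖δ‖ := mul_add _ _ _
        _ ≤ _ := by gcongr
    have e6 : c * ‖δ‖ ≤ 2 * N * ‖u 0‖ * |t| := by linarith
    calc ‖δ‖ = c * ‖δ‖ / c := by field_simp
      _ ≤ 2 * N * ‖u 0‖ * |t| / c := by gcongr
      _ = _ := by ring
  set L : ℝ := 2 * N * ‖u 0‖ / c with hL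
  have hLpos : 0 ≤ L := by positivity
  rw [hasDerivAt_iff_isLittleO]
  have hO : (fun t : ℝ => 1 / 2 * ‖T (u t) - a‖ ^ 2 - 1 / 2 * ‖T (u 0) - a‖ ^ 2 -
      (t - 0) • M (u 0) v) =O[𝓝 0] fun t => t ^ 2 := by
    refine Asymptotics.IsBigO.of_bound (N * L * ‖v‖ + 1 / 2 * (‖T‖ * L) ^ 2) ?_
    filter_upwards [hu, hδ] with t ht hδt
    set δ := u t - u 0 with hδdef
    have hsub : ∀ (A : H →L[ℝ] H →L[ℝ] ℝ) w, A δ w = A (u t) w - A (u 0) w := fun A w => by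
      rw [hδdef, map_sub]; rfl
    have e1 : B δ v = -(t * M (u t) v) := by
      have h1 := ht v
      have h2 := hu0 v
      rw [hsub]
      linarith
    have e2 : ⟪T (u 0) - a, T δ⟫ = t * M (u 0) v + t * M δ v := by
      have h1 := hv δ
      rw [hBs, e1] at h1
      have h2 : M (u t) v = M (u 0) v + M δ v := by
        rw [hsub]; ring
      rw [h2] at h1
      linarith
    have e3 : T (u t) - a = (T (u 0) - a) + T δ := by
      rw [hδdef, map_sub]; abel
    have e4 : 1 / 2 * ‖T (u t) - a‖ ^ 2 - 1 / 2 * ‖T (u 0) - a‖ ^ 2 - (t - 0) • M (u 0) v =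
        t * M δ v + 1 / 2 * ‖T δ‖ ^ 2 := by
      rw [e3, norm_add_sq_real, e2, smul_eq_mul]
      ring
    have e5 : ‖T δ‖ ≤ ‖T‖ * L * |t| := by
      calc ‖T δ‖ ≤ ‖T‖ * ‖δ‖ := T.le_opNorm δ
        _ ≤ ‖T‖ * (L * |t|) := by gcongr
        _ = _ := by ring
    rw [e4, Real.norm_eq_abs, norm_pow, Real.norm_eq_abs]
    calc |t * M δ v + 1 / 2 * ‖T δ‖ ^ 2| ≤ |t * M δ v| + |1 / 2 * ‖T δ‖ ^ 2| := abs_add_le _ _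
      _ = |t| * |M δ v| + 1 / 2 * ‖T δ‖ ^ 2 := by
          rw [abs_mul, abs_of_nonneg (by positivity : 0 ≤ 1 / 2 * ‖T δ‖ ^ 2)]
      _ ≤ |t| * (N * (L * |t|) * ‖v‖) + 1 / 2 * (‖T‖ * L * |t|) ^ 2 := by
          gcongr
          refine (hM δ v).trans ?_
          gcongr
      _ = _ := by ring
  refine hO.trans_isLittleO ?_
  simpa using Asymptotics.isLittleO_pow_id (𝕜 := ℝ) one_lt_two

end Abstract

/-! ### Weighted `L²` forms -/

section Weighted

variable {α : Type*} [MeasurableSpace α] {μ : Measure α} {F : Type*} [NormedAddCommGroup F]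
  [InnerProductSpace ℝ F]

theorem integrable_weight_inner {κ : α → ℝ} {M : ℝ} (hκm : AEStronglyMeasurable κ μ)
    (hκ : ∀ x, |κ x| ≤ M) (f g : Lp F 2 μ) : Integrable (fun x => κ x * ⟪f x, g x⟫) μ :=
  (L2.integrable_inner (𝕜 := ℝ) f g).bdd_mul hκm (ae_of_all _ hκ)

/-- The bounded bilinear form `(f, g) ↦ ∫ κ ⟪f, g⟫` on `L²`, for a bounded weight `κ`. -/
def weightedInner {κ : α → ℝ} {M : ℝ} (hM : 0 ≤ M) (hκm : AEStronglyMeasurable κ μ)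
    (hκ : ∀ x, |κ x| ≤ M) :
    Lp F 2 μ →L[ℝ] Lp F 2 μ →L[ℝ] ℝ :=
  LinearMap.mkContinuous₂ (LinearMap.mk₂ ℝ (fun f g : Lp F 2 μ => ∫ x, κ x * ⟪f x, g x⟫ ∂μ)
    (by
      intro f f' g
      rw [← integral_add (integrable_weight_inner hκm hκ _ _) (integrable_weight_inner hκm hκ _ _)]
      refine integral_congr_ae ?_
      filter_upwards [Lp.coeFn_add f f'] with x hx
      rw [hx, Pi.add_apply, inner_add_left, mul_add])
    (by
      intro c f g
      rw [smul_eq_mul, ← integral_const_mul]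
      refine integral_congr_ae ?_
      filter_upwards [Lp.coeFn_smul c f] with x hx
      rw [hx, Pi.smul_apply, real_inner_smul_left]
      ring)
    (by
      intro f g g'
      rw [← integral_add (integrable_weight_inner hκm hκ _ _) (integrable_weight_inner hκm hκ _ _)]
      refine integral_congr_ae ?_
      filter_upwards [Lp.coeFn_add g g'] with x hx
      rw [hx, Pi.add_apply, inner_add_right, mul_add])
    (by
      intro c f g
      rw [smul_eq_mul, ← integral_const_mul]
      refine integral_congr_ae ?_
      filter_upwards [Lp.coeFn_smul c g] with x hx
      rw [hx, Pi.smul_apply, real_inner_smul_right]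
      ring)) M (by
    intro f g
    have hi : Integrable (fun x => M * (‖f x‖ * ‖g x‖)) μ :=
      ((Lp.memLp f).norm.integrable_mul (Lp.memLp g).norm).const_mul M
    have h2 : ∫ x, ‖f x‖ * ‖g x‖ ∂μ ≤ ‖f‖ * ‖g‖ := by
      have hf := (Lp.memLp f).norm
      have hg := (Lp.memLp g).norm
      have h3 := real_inner_le_norm (hf.toLp _) (hg.toLp _)
      rw [Lp.norm_toLp, Lp.norm_toLp, eLpNorm_norm, eLpNorm_norm, ← Lp.norm_def, ← Lp.norm_def,
        L2.inner_def] at h3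
      refine le_trans (integral_congr_ae ?_).le h3
      filter_upwards [hf.coeFn_toLp, hg.coeFn_toLp] with x hx hx'
      rw [hx, hx']
      exact mul_comm _ _
    calc ‖∫ x, κ x * ⟪f x, g x⟫ ∂μ‖ ≤ ∫ x, M * (‖f x‖ * ‖g x‖) ∂μ := by
          refine norm_integral_le_of_norm_le hi (ae_of_all _ fun x => ?_)
          rw [norm_mul]
          exact mul_le_mul (hκ x) (norm_inner_le_norm _ _) (norm_nonneg _) hM
      _ = M * ∫ x, ‖f x‖ * ‖g x‖ ∂μ := integral_const_mul _ _
      _ ≤ M * (‖f‖ * ‖g‖) := by gcongr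
      _ = _ := by ring)

theorem exists_weighted_form {κ : α → ℝ} {M : ℝ} (hM : 0 ≤ M) (hκm : AEStronglyMeasurable κ μ)
    (hκ : ∀ x, |κ x| ≤ M) {H : Type*} [NormedAddCommGroup H] [NormedSpace ℝ H]
    (L : H →L[ℝ] Lp F 2 μ) :
    ∃ A : H →L[ℝ] H →L[ℝ] ℝ, ∀ u w, A u w = ∫ x, κ x * ⟪L u x, L w x⟫ ∂μ :=
  ⟨(weightedInner hM hκm hκ).bilinearComp L L, fun _ _ => rfl⟩

theorem mul_norm_sq_le_integral {κ : α → ℝ} {M : ℝ} (hκm : AEStronglyMeasurable κ μ)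
    (hκ : ∀ x, |κ x| ≤ M) {c : ℝ} (hc : ∀ᵐ x ∂μ, c ≤ κ x) (f : Lp F 2 μ) :
    c * ‖f‖ ^ 2 ≤ ∫ x, κ x * ⟪f x, f x⟫ ∂μ := by
  rw [← real_inner_self_eq_norm_sq, L2.inner_def, ← integral_const_mul]
  refine integral_mono_ae ((L2.integrable_inner (𝕜 := ℝ) f f).const_mul c)
    (integrable_weight_inner hκm hκ f f) ?_
  filter_upwards [hc] with x hx
  exact mul_le_mul_of_nonneg_right hx real_inner_self_nonneg

end Weighted

/-! ### The Robin form and the cost functional -/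

/-- Integration of continuous functions against an integrable density is a continuous functional. -/
theorem exists_integral_functional {S : Type*} [TopologicalSpace S] [CompactSpace S]
    [MeasurableSpace S] [BorelSpace S] {μ : Measure S} {h : S → ℝ} (hh : Integrable h μ) :
    ∃ D : C(S, ℝ) →L[ℝ] ℝ, ∀ γ : C(S, ℝ), D γ = ∫ s, γ s * h s ∂μ := by
  have hb : ∀ (γ : C(S, ℝ)) s, ‖γ s‖ ≤ ‖γ‖ := fun γ s => γ.norm_coe_le_norm s
  have hi : ∀ γ : C(S, ℝ), Integrable (fun s => γ s * h s) μ := fun γ =>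
    hh.bdd_mul γ.continuous.aestronglyMeasurable (ae_of_all _ (hb γ))
  refine ⟨LinearMap.mkContinuous
    { toFun := fun γ => ∫ s, γ s * h s ∂μ
      map_add' := fun γ γ' => ?_
      map_smul' := fun c γ => ?_ } (∫ s, ‖h s‖ ∂μ) fun γ => ?_, fun γ => rfl⟩
  · rw [← integral_add (hi γ) (hi γ')]
    simp only [ContinuousMap.add_apply, add_mul]
  · rw [RingHom.id_apply, smul_eq_mul, ← integral_const_mul]
    simp only [ContinuousMap.smul_apply, smul_eq_mul, mul_assoc]
  · rw [mul_comm, ← integral_const_mul]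
    refine norm_integral_le_of_norm_le (hh.norm.const_mul _) (ae_of_all _ fun s => ?_)
    rw [norm_mul]
    exact mul_le_mul_of_nonneg_right (hb γ s) (norm_nonneg _)

theorem aestronglyMeasurable_conductivity {Ω Ω₁ : Set (E d)} (hΩ : IsOpen Ω) (hΩ₁ : IsOpen Ω₁)
    (σ₁ σ₂ : ℝ) : AEStronglyMeasurable (conductivity Ω Ω₁ σ₁ σ₂) (volume.restrict Ω) :=
  (stronglyMeasurable_const.indicator hΩ₁.measurableSet).add
    (stronglyMeasurable_const.indicator
      (hΩ.measurableSet.diff isClosed_closure.measurableSet)) |>.aestronglyMeasurable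

theorem abs_conductivity_le (Ω Ω₁ : Set (E d)) {σ₁ σ₂ : ℝ} (hσ₁ : 0 < σ₁) (hσ₂ : 0 < σ₂)
    (x : E d) : |conductivity Ω Ω₁ σ₁ σ₂ x| ≤ σ₁ + σ₂ := by
  refine (abs_add_le _ _).trans (add_le_add ?_ ?_)
  · by_cases h : x ∈ Ω₁ <;> simp [h, hσ₁.le, abs_of_pos hσ₁]
  · by_cases h : x ∈ Ω \ closure Ω₁
    · rw [indicator_of_mem h, abs_of_pos hσ₂]
    · rw [indicator_of_notMem h, abs_zero]; exact hσ₂.le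

/-- The conductivity is bounded below almost everywhere, since the interface, where it is zero by
definition, is a null set. -/
theorem le_conductivity {Ω Ω₁ : Set (E d)} (hΩ : IsOpen Ω) (hΩ₁ : IsOpen Ω₁) (σ₁ σ₂ : ℝ)
    (hnull : (volume : Measure (E d)) (frontier Ω₁) = 0) :
    ∀ᵐ x ∂(volume.restrict Ω), min σ₁ σ₂ ≤ conductivity Ω Ω₁ σ₁ σ₂ x := by
  have h1 : ∀ᵐ x ∂(volume.restrict Ω), x ∉ frontier Ω₁ :=
    ae_restrict_of_ae (measure_eq_zero_iff_ae_notMem.1 hnull)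
  filter_upwards [h1, ae_restrict_mem hΩ.measurableSet] with x hx hxΩ
  rw [conductivity]
  by_cases h : x ∈ Ω₁
  · have h2 : x ∉ Ω \ closure Ω₁ := fun h' => h'.2 (subset_closure h)
    rw [indicator_of_mem h, indicator_of_notMem h2, add_zero]
    exact min_le_left _ _
  · have h2 : x ∈ Ω \ closure Ω₁ := ⟨hxΩ, fun h' => hx ⟨h', by rwa [hΩ₁.interior_eq]⟩⟩
    rw [indicator_of_notMem h, indicator_of_mem h2, zero_add]
    exact min_le_right _ _

/-- A continuous function on a compact space that is positive has a positive lower bound. -/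
theorem exists_pos_le {S : Type*} [TopologicalSpace S] [CompactSpace S] (γ : C(S, ℝ))
    (hγ : ∀ s, 0 < γ s) : ∃ m, 0 < m ∧ ∀ s, m ≤ γ s := by
  rcases isEmpty_or_nonempty S with h | h
  · exact ⟨1, one_pos, fun s => (h.false s).elim⟩
  · obtain ⟨s₀, -, hs₀⟩ := isCompact_univ.exists_isMinOn univ_nonempty γ.continuous.continuousOn
    exact ⟨γ s₀, hγ s₀, fun s => hs₀ (mem_univ s)⟩

/-- The bilinear form `∫ κ ⟪G u, G w⟫ + ∫ γ (T u) (T w)` on a Hilbert space `H` is bounded,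
symmetric, affine in the coefficient `γ`, and coercive for positive `γ`, provided that `κ` is
bounded above and below and that the operators `G` and `T` together control the norm of `H`. -/
theorem exists_coercive_form {H : Type*} [NormedAddCommGroup H] [InnerProductSpace ℝ H]
    {α : Type*} [MeasurableSpace α] {μ : Measure α} {F : Type*} [NormedAddCommGroup F]
    [InnerProductSpace ℝ F] {S : Type*} [TopologicalSpace S] [CompactSpace S] [MeasurableSpace S]
    [BorelSpace S] {ν : Measure S} {κ : α → ℝ} {m K : ℝ} (hκm : AEStronglyMeasurable κ μ)
    (hK : 0 ≤ K) (hκ : ∀ x, |κ x| ≤ K) (hm : 0 < m) (hmκ : ∀ᵐ x ∂μ, m ≤ κ x)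
    (G : H →L[ℝ] Lp F 2 μ) (T : H →L[ℝ] Lp ℝ 2 ν) {C : ℝ} (hC0 : 0 < C)
    (hC : ∀ u : H, ‖u‖ ^ 2 ≤ C * (‖G u‖ ^ 2 + ‖T u‖ ^ 2)) :
    ∃ (A : H →L[ℝ] H →L[ℝ] ℝ) (M : C(S, ℝ) → H →L[ℝ] H →L[ℝ] ℝ),
      (∀ u w, A u w = ∫ x, κ x * ⟪G u x, G w x⟫ ∂μ) ∧
      (∀ γ u w, M γ u w = ∫ s, γ s * (T u s * T w s) ∂ν) ∧
      (∀ γ u w, (A + M γ) u w = (A + M γ) w u) ∧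
      (∀ γ γ' u w, ∀ t : ℝ, M (γ + t • γ') u w = M γ u w + t * M γ' u w) ∧
      ∀ γ : C(S, ℝ), (∀ s, 0 < γ s) → IsCoercive (A + M γ) := by
  have hγm : ∀ γ : C(S, ℝ), AEStronglyMeasurable γ ν := fun γ => γ.continuous.aestronglyMeasurable
  have hγb : ∀ (γ : C(S, ℝ)) s, |γ s| ≤ ‖γ‖ := fun γ s => γ.norm_coe_le_norm s
  obtain ⟨A, hA⟩ := exists_weighted_form hK hκm hκ G
  choose M hM' using fun γ : C(S, ℝ) =>
    exists_weighted_form (norm_nonneg γ) (hγm γ) (hγb γ) T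
  have hM : ∀ γ u w, M γ u w = ∫ s, γ s * (T u s * T w s) ∂ν := by
    intro γ u w
    rw [hM']
    refine integral_congr_ae (ae_of_all _ fun s => ?_)
    exact congrArg (γ s * ·) (mul_comm (T w s) (T u s))
  have hadd : ∀ γ u w, (A + M γ) u w = A u w + M γ u w := fun γ u w => rfl
  refine ⟨A, M, hA, hM, fun γ u w => ?_, fun γ γ' u w t => ?_, fun γ hγ => ?_⟩
  · rw [hadd, hadd, hA, hA, hM, hM]
    simp only [real_inner_comm, mul_comm]
  · have hi : ∀ γ : C(S, ℝ), Integrable (fun s => γ s * ⟪T u s, T w s⟫) ν := fun γ =>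
      integrable_weight_inner (hγm γ) (hγb γ) _ _
    rw [hM', hM', hM', ← integral_const_mul, ← integral_add (hi γ) ((hi γ').const_mul t)]
    refine integral_congr_ae (ae_of_all _ fun s => ?_)
    simp only [ContinuousMap.add_apply, ContinuousMap.smul_apply, smul_eq_mul]
    ring
  · obtain ⟨c, hc, hcγ⟩ := exists_pos_le γ hγ
    have hpos : 0 < min m c := lt_min hm hc
    refine ⟨min m c / C, by positivity, fun u => ?_⟩
    have h1 : m * ‖G u‖ ^ 2 ≤ A u u := by
      rw [hA]
      exact mul_norm_sq_le_integral hκm hκ hmκ (G u)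
    have h2 : c * ‖T u‖ ^ 2 ≤ M γ u u := by
      rw [hM']
      exact mul_norm_sq_le_integral (hγm γ) (hγb γ) (ae_of_all _ hcγ) (T u)
    rw [hadd]
    calc min m c / C * ‖u‖ * ‖u‖ = min m c / C * ‖u‖ ^ 2 := by ring
      _ ≤ min m c / C * (C * (‖G u‖ ^ 2 + ‖T u‖ ^ 2)) := by
        gcongr
        exact hC u
      _ = min m c * ‖G u‖ ^ 2 + min m c * ‖T u‖ ^ 2 := by field_simp
      _ ≤ m * ‖G u‖ ^ 2 + c * ‖T u‖ ^ 2 := by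
        gcongr
        · exact min_le_left _ _
        · exact min_le_right _ _
      _ ≤ _ := add_le_add h1 h2

theorem integral_mul_eq_inner {S : Set (E d)} (f g : L2Surface S) :
    ∫ s, f s * g s ∂surfaceMeasure S = ⟪f, g⟫ := by
  rw [L2.inner_def]
  exact integral_congr_ae (ae_of_all _ fun s => mul_comm _ _)

theorem integral_sub_mul_eq_inner {S : Set (E d)} (f f' g : L2Surface S) :
    ∫ s, (f s - f' s) * g s ∂surfaceMeasure S = ⟪f - f', g⟫ := by
  rw [← integral_mul_eq_inner]
  refine integral_congr_ae ?_
  filter_upwards [Lp.coeFn_sub f f'] with s hs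
  rw [hs, Pi.sub_apply]

theorem integral_sub_sq_eq_norm_sq {S : Set (E d)} (f f' : L2Surface S) :
    ∫ s, (f s - f' s) ^ 2 ∂surfaceMeasure S = ‖f - f'‖ ^ 2 := by
  rw [← real_inner_self_eq_norm_sq, ← integral_mul_eq_inner]
  refine integral_congr_ae ?_
  filter_upwards [Lp.coeFn_sub f f'] with s hs
  rw [hs, Pi.sub_apply, sq]

theorem hasDerivAt_integral_sq {S : Type*} [TopologicalSpace S] [CompactSpace S]
    [MeasurableSpace S] [BorelSpace S] {μ : Measure S} [IsFiniteMeasure μ] (γ γ' : C(S, ℝ)) :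
    HasDerivAt (fun t : ℝ => ∫ s, (γ + t • γ') s ^ 2 ∂μ) (2 * ∫ s, γ' s * γ s ∂μ) 0 := by
  have hi : ∀ f : C(S, ℝ), Integrable f μ := fun f =>
    f.continuous.integrable_of_hasCompactSupport (HasCompactSupport.of_compactSpace f)
  have h : ∀ t : ℝ, ∫ s, (γ + t • γ') s ^ 2 ∂μ =
      ∫ s, γ s ^ 2 ∂μ + t * (2 * ∫ s, γ' s * γ s ∂μ) + t ^ 2 * ∫ s, γ' s ^ 2 ∂μ := by
    intro t
    have i1 : Integrable (fun s => γ s ^ 2) μ := hi (γ ^ 2)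
    have i2 : Integrable (fun s => γ' s * γ s) μ := hi (γ' * γ)
    have i3 : Integrable (fun s => γ' s ^ 2) μ := hi (γ' ^ 2)
    have i4 : Integrable (fun s => γ s ^ 2 + t * (2 * (γ' s * γ s))) μ :=
      i1.add ((i2.const_mul 2).const_mul t)
    rw [← integral_const_mul, ← integral_const_mul, ← integral_const_mul,
      ← integral_add i1 ((i2.const_mul 2).const_mul t), ← integral_add i4 (i3.const_mul _)]
    refine integral_congr_ae (ae_of_all _ fun s => ?_)
    simp only [ContinuousMap.add_apply, ContinuousMap.smul_apply, smul_eq_mul]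
    ring
  simp only [h]
  have h1 := ((hasDerivAt_id (0 : ℝ)).mul_const (2 * ∫ s, γ' s * γ s ∂μ)).const_add
    (∫ s, γ s ^ 2 ∂μ)
  have h2 := ((hasDerivAt_id (0 : ℝ)).pow 2).mul_const (∫ s, γ' s ^ 2 ∂μ)
  have h3 := h1.add h2
  simp only [id_eq, Nat.cast_ofNat, Nat.add_one_sub_one, pow_one, mul_zero, zero_mul, one_mul,
    add_zero] at h3
  exact h3

/-- The state, the adjoint state and the derivative of the cost functional for a problem on a
Hilbert space `H` that is given by a form as in `exists_coercive_form`, with data `g` and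
observation operator `T'`. Any choice `U` of solutions of the state equation may be used in the
cost, as solutions are unique for positive coefficients. -/
theorem exists_state_adjoint_hasLineDerivAt {H X : Type*} [NormedAddCommGroup H]
    [InnerProductSpace ℝ H] [CompleteSpace H] [NormedAddCommGroup X] [InnerProductSpace ℝ X]
    {α : Type*} [MeasurableSpace α] {μ : Measure α} {F : Type*} [NormedAddCommGroup F]
    [InnerProductSpace ℝ F] {S : Type*} [TopologicalSpace S] [CompactSpace S] [MeasurableSpace S]
    [BorelSpace S] {ν : Measure S} [IsFiniteMeasure ν] {κ : α → ℝ} {m K : ℝ}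
    (hκm : AEStronglyMeasurable κ μ) (hK : 0 ≤ K) (hκ : ∀ x, |κ x| ≤ K) (hm : 0 < m)
    (hmκ : ∀ᵐ x ∂μ, m ≤ κ x) (G : H →L[ℝ] Lp F 2 μ) (T : H →L[ℝ] Lp ℝ 2 ν) {C : ℝ} (hC0 : 0 < C)
    (hC : ∀ u : H, ‖u‖ ^ 2 ≤ C * (‖G u‖ ^ 2 + ‖T u‖ ^ 2)) (T' : H →L[ℝ] X) (g a : X) (lam : ℝ)
    {B : C(S, ℝ) → H → H → ℝ}
    (hB : ∀ γ u w, B γ u w = (∫ x, κ x * ⟪G u x, G w x⟫ ∂μ) + ∫ s, γ s * (T u s * T w s) ∂ν)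
    {U : C(S, ℝ) → H}
    (hU : ∀ γ, (∃ u, ∀ w, B γ u w = ⟪g, T' w⟫) → ∀ w, B γ (U γ) w = ⟪g, T' w⟫)
    (γ : C(S, ℝ)) (hγ : ∀ s, 0 < γ s) :
    ∃ u v : H, (∀ u', (∀ w, B γ u' w = ⟪g, T' w⟫) ↔ u' = u) ∧
      (∀ v', (∀ w, B γ v' w + ⟪T' u - a, T' w⟫ = 0) ↔ v' = v) ∧
      ∃ D : C(S, ℝ) →L[ℝ] ℝ, ∀ γ' : C(S, ℝ),
        D γ' = (∫ s, γ' s * (T u s * T v s + lam * γ s) ∂ν) ∧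
        HasLineDerivAt ℝ
          (fun κ => 1 / 2 * ‖T' (U κ) - a‖ ^ 2 + lam / 2 * ∫ s, κ s ^ 2 ∂ν) (D γ') γ γ' := by
  obtain ⟨A, M, hA, hM, hsymm, hMadd, hcoer⟩ := exists_coercive_form hκm hK hκ hm hmκ G T hC0 hC
  have hBA : ∀ η u w, B η u w = (A + M η) u w := fun η u w => by
    rw [hB, ← hA, ← hM]
    rfl
  simp only [hBA] at hU ⊢
  have hexists : ∀ η : C(S, ℝ), (∀ s, 0 < η s) →
      ∃ u, ∀ u', (∀ w, (A + M η) u' w = ⟪g, T' w⟫) ↔ u' = u := fun η hη =>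
    exists_forall_eq_iff_of_isCoercive (hcoer η hη) ((innerSL ℝ g).comp T')
  have hspec : ∀ η : C(S, ℝ), (∀ s, 0 < η s) → ∀ w, (A + M η) (U η) w = ⟪g, T' w⟫ := by
    intro η hη
    obtain ⟨u, hu⟩ := hexists η hη
    exact hU η ⟨u, (hu u).2 rfl⟩
  obtain ⟨u, hu⟩ := hexists γ hγ
  have hUγ : U γ = u := (hu _).1 (hspec γ hγ)
  obtain ⟨v, hv⟩ := exists_forall_eq_iff_of_isCoercive (hcoer γ hγ)
    (-((innerSL ℝ (T' u - a)).comp T'))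
  have hadj : ∀ v', (∀ w, (A + M γ) v' w + ⟪T' u - a, T' w⟫ = 0) ↔ v' = v := by
    intro v'
    rw [← hv]
    refine forall_congr' fun w => ?_
    rw [add_eq_zero_iff_eq_neg]
    rfl
  have hγi : ∀ f : C(S, ℝ), Integrable f ν := fun f =>
    f.continuous.integrable_of_hasCompactSupport (HasCompactSupport.of_compactSpace f)
  have huv : Integrable (fun s => T u s * T v s) ν :=
    (Lp.memLp (T u)).integrable_mul (Lp.memLp (T v))
  obtain ⟨D, hD⟩ := exists_integral_functional (huv.add ((hγi γ).const_mul lam))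
  refine ⟨u, v, hu, hadj, D, fun γ' => ⟨hD γ', ?_⟩⟩
  -- the coefficients near `γ` on the line in the direction `γ'` are positive
  have hpos : ∀ᶠ t : ℝ in 𝓝 0, ∀ s, 0 < (γ + t • γ') s := by
    obtain ⟨c, hc, hcγ⟩ := exists_pos_le γ hγ
    have h1 : Tendsto (fun t : ℝ => |t| * ‖γ'‖) (𝓝 0) (𝓝 (|0| * ‖γ'‖)) :=
      (continuous_abs.mul continuous_const).tendsto 0
    rw [abs_zero, zero_mul] at h1
    filter_upwards [h1.eventually (gt_mem_nhds hc)] with t ht s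
    have h2 : |t * γ' s| ≤ |t| * ‖γ'‖ := by
      rw [abs_mul]
      exact mul_le_mul_of_nonneg_left (γ'.norm_coe_le_norm s) (abs_nonneg t)
    have h3 := neg_le_of_abs_le h2
    have h4 := hcγ s
    simp only [ContinuousMap.add_apply, ContinuousMap.smul_apply, smul_eq_mul]
    linarith
  have hU0 : U (γ + (0 : ℝ) • γ') = u := by simp only [zero_smul, add_zero, hUγ]
  have hcurve : ∀ᶠ t : ℝ in 𝓝 0, ∀ w,
      (A + M γ) (U (γ + t • γ')) w + t * M γ' (U (γ + t • γ')) w =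
        ((innerSL ℝ g).comp T') w := by
    filter_upwards [hpos] with t ht w
    have h1 := hspec _ ht w
    simp only [add_apply, hMadd] at h1
    simp only [add_apply, ContinuousLinearMap.comp_apply, innerSL_apply_apply]
    linarith
  have hvU : ∀ w, (A + M γ) v w + ⟪T' (U (γ + (0 : ℝ) • γ')) - a, T' w⟫ = 0 := by
    rw [hU0]
    exact (hadj v).2 rfl
  have h1 := hasDerivAt_half_norm_sq (hcoer γ hγ) (hsymm γ) hcurve hvU
  have h2 := (hasDerivAt_integral_sq (μ := ν) γ γ').const_mul (lam / 2)
  have h3 : D γ' = M γ' u v + lam / 2 * (2 * ∫ s, γ' s * γ s ∂ν) := by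
    have hi : Integrable (fun s => γ' s * (T u s * T v s)) ν :=
      huv.bdd_mul γ'.continuous.aestronglyMeasurable (ae_of_all _ fun s => γ'.norm_coe_le_norm s)
    have hi' : Integrable (fun s => γ' s * γ s) ν := hγi (γ' * γ)
    rw [hD, hM, ← mul_assoc, div_mul_cancel₀ lam two_ne_zero, ← integral_const_mul,
      ← integral_add hi (hi'.const_mul lam)]
    refine integral_congr_ae (ae_of_all _ fun s => ?_)
    simp only [Pi.add_apply]
    ring
  rw [hU0] at h1
  rw [HasLineDerivAt, h3]
  exact h1.add h2

theorem AdmitsTrace.of_lipschitz {U Ω : Set (E d)} (hU : HasLipschitzBoundary U)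
    (hb : Bornology.IsBounded U) (hΩ : IsOpen Ω) (hsub : U ⊆ Ω) : AdmitsTrace Ω (frontier U) where
  isCompact := Metric.isCompact_of_isClosed_isBounded isClosed_frontier
    (hb.closure.subset frontier_subset_closure)
  bound := exists_trace_bound hU hb hΩ.measurableSet hsub

theorem frontier_nonempty_of_isBounded {U : Set (E d)} (hd : 0 < d) (hne : U.Nonempty)
    (hb : Bornology.IsBounded U) : (frontier U).Nonempty := by
  have : Nonempty (Fin d) := ⟨⟨0, hd⟩⟩
  have : Nontrivial (E d) := inferInstance
  rw [nonempty_iff_ne_empty, ne_eq, frontier_eq_empty_iff, not_or]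
  refine ⟨hne.ne_empty, ?_⟩
  rintro rfl
  exact NormedSpace.unbounded_univ ℝ (E d) hb

end RobinTransmission

end

theorem theorem6p3 {d : ℕ} (hd : 2 ≤ d)
    (Ω Ω₁ : Set (EuclideanSpace ℝ (Fin d)))
    (hΩ_open : IsOpen Ω) (hΩ_conn : IsConnected Ω) (hΩ_bdd : Bornology.IsBounded Ω)
    (hΩ_lip : RobinTransmission.HasLipschitzBoundary Ω)
    (hΩ₁_open : IsOpen Ω₁) (hΩ₁_ne : Ω₁.Nonempty) (hΩ₁_sub : closure Ω₁ ⊆ Ω)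
    (hΩ₁_lip : RobinTransmission.HasLipschitzBoundary Ω₁)
    (hΩ₂_conn : IsConnected (Ω \ closure Ω₁))
    (σ₁ σ₂ : ℝ) (hσ₁ : 0 < σ₁) (hσ₂ : 0 < σ₂)
    (g uₐ : RobinTransmission.L2Surface (frontier Ω)) (lam : ℝ)
    (γ : C(frontier Ω₁, ℝ)) (hγ : ∀ s, 0 < γ s) :
    ∃ u v : RobinTransmission.H1 Ω,
      (∀ u' : RobinTransmission.H1 Ω,
        RobinTransmission.IsState Ω Ω₁ σ₁ σ₂ g γ u' ↔ u' = u) ∧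
      (∀ v' : RobinTransmission.H1 Ω,
        RobinTransmission.IsAdjointState Ω Ω₁ σ₁ σ₂ uₐ γ u v' ↔ v' = v) ∧
      ∃ D : C(frontier Ω₁, ℝ) →L[ℝ] ℝ, ∀ γ' : C(frontier Ω₁, ℝ),
        D γ' = (∫ s, γ' s *
          (RobinTransmission.trace (frontier Ω₁) u s * RobinTransmission.trace (frontier Ω₁) v s
            + lam * γ s) ∂(RobinTransmission.surfaceMeasure (frontier Ω₁))) ∧
        HasLineDerivAt ℝ (RobinTransmission.cost Ω Ω₁ σ₁ σ₂ g uₐ lam) (D γ') γ γ' := by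
  have hsub : Ω₁ ⊆ Ω := subset_closure.trans hΩ₁_sub
  have hb₁ : Bornology.IsBounded Ω₁ := hΩ_bdd.subset hsub
  have hd0 : 0 < d := by omega
  have hΓ : RobinTransmission.AdmitsTrace Ω (frontier Ω₁) :=
    RobinTransmission.AdmitsTrace.of_lipschitz hΩ₁_lip hb₁ hΩ_open hsub
  have hS : RobinTransmission.AdmitsTrace Ω (frontier Ω) :=
    RobinTransmission.AdmitsTrace.of_lipschitz hΩ_lip hΩ_bdd hΩ_open Subset.rfl
  have hcpt : CompactSpace (frontier Ω₁) := isCompact_iff_compactSpace.1 hΓ.isCompact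
  have hfin := hΓ.isFiniteMeasure hΩ_bdd
  obtain ⟨T, hT, hTs⟩ := RobinTransmission.exists_traceL hΩ_open hΩ_bdd hΩ_lip hΓ
  obtain ⟨T', hT', -⟩ := RobinTransmission.exists_traceL hΩ_open hΩ_bdd hΩ_lip hS
  have hne : (frontier Ω₁).Nonempty :=
    RobinTransmission.frontier_nonempty_of_isBounded hd0 hΩ₁_ne hb₁
  obtain ⟨C, hC0, hC⟩ := RobinTransmission.exists_poincare hΩ_open hΩ_bdd hΩ_lip hΓ
    (RobinTransmission.controlled_of_lipschitz hΩ_open hΩ_conn.isPreconnected hΩ_bdd hΩ_lip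
      hΩ₁_lip hne hsub) hTs
  -- the constant `C + 1` also accounts for the gradient in the norm of `H¹(Ω)`
  have hC' : ∀ u : RobinTransmission.H1 Ω,
      ‖u‖ ^ 2 ≤ (C + 1) * (‖RobinTransmission.gradL Ω u‖ ^ 2 + ‖T u‖ ^ 2) := fun u => by
    rw [RobinTransmission.norm_sq_H1, RobinTransmission.gradL_apply]
    linarith [hC u, sq_nonneg ‖T u‖]
  have hform : ∀ κ u w, RobinTransmission.robinForm Ω Ω₁ σ₁ σ₂ κ u w =
      (∫ x in Ω, RobinTransmission.conductivity Ω Ω₁ σ₁ σ₂ x *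
        ⟪RobinTransmission.gradL Ω u x, RobinTransmission.gradL Ω w x⟫) +
        ∫ s, κ s * (T u s * T w s) ∂(RobinTransmission.surfaceMeasure (frontier Ω₁)) := by
    intro κ u w
    rw [RobinTransmission.robinForm, hT, hT]
    simp only [mul_assoc, RobinTransmission.gradL_apply]
  have hstate : ∀ κ u, RobinTransmission.IsState Ω Ω₁ σ₁ σ₂ g κ u ↔
      ∀ w, RobinTransmission.robinForm Ω Ω₁ σ₁ σ₂ κ u w = ⟪g, T' w⟫ := by
    intro κ u
    refine forall_congr' fun w => ?_
    rw [hT', RobinTransmission.integral_mul_eq_inner]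
  have hadj : ∀ u v, RobinTransmission.IsAdjointState Ω Ω₁ σ₁ σ₂ uₐ γ u v ↔
      ∀ w, RobinTransmission.robinForm Ω Ω₁ σ₁ σ₂ γ v w + ⟪T' u - uₐ, T' w⟫ = 0 := by
    intro u v
    refine forall_congr' fun w => ?_
    rw [hT', hT', RobinTransmission.integral_sub_mul_eq_inner]
  have hcost : RobinTransmission.cost Ω Ω₁ σ₁ σ₂ g uₐ lam = fun κ =>
      1 / 2 * ‖T' (RobinTransmission.state Ω Ω₁ σ₁ σ₂ g κ) - uₐ‖ ^ 2 +
        lam / 2 * ∫ s, κ s ^ 2 ∂(RobinTransmission.surfaceMeasure (frontier Ω₁)) := by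
    funext κ
    rw [RobinTransmission.cost, hT', RobinTransmission.integral_sub_sq_eq_norm_sq]
  have hspec : ∀ κ, (∃ u, ∀ w, RobinTransmission.robinForm Ω Ω₁ σ₁ σ₂ κ u w = ⟪g, T' w⟫) →
      ∀ w, RobinTransmission.robinForm Ω Ω₁ σ₁ σ₂ κ (RobinTransmission.state Ω Ω₁ σ₁ σ₂ g κ) w =
        ⟪g, T' w⟫ := by
    rintro κ ⟨u, hu⟩
    exact (hstate κ _).1 (Classical.epsilon_spec
      (p := fun u => RobinTransmission.IsState Ω Ω₁ σ₁ σ₂ g κ u) ⟨u, (hstate κ u).2 hu⟩)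
  simp only [hstate, hadj, hcost, hT]
  exact RobinTransmission.exists_state_adjoint_hasLineDerivAt
    (RobinTransmission.aestronglyMeasurable_conductivity hΩ_open hΩ₁_open σ₁ σ₂)
    (add_pos hσ₁ hσ₂).le (RobinTransmission.abs_conductivity_le Ω Ω₁ hσ₁ hσ₂) (lt_min hσ₁ hσ₂)
    (RobinTransmission.le_conductivity hΩ_open hΩ₁_open σ₁ σ₂ (hΓ.volume_eq_zero hΩ_bdd hd0))
    (RobinTransmission.gradL Ω) T (by positivity : 0 < C + 1) hC' T' g uₐ lam hform hspec γ hγ
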